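/- Let $H$ be a real separable Hilbert space and let $W=\{W(h):h\in H\}$ be an isonormal Gaussian process over $H$ on a probability space $(\Omega,\mathcal F,\mathbb P)$, i.e. a centered (jointly) Gaussian family with $\mathbb E[W(h)W(k)]=\langle h,k\rangle_H$. Fix $n\ge 1$. Let $I_n$ be the $n$-th multiple Wiener–Itô integral, i.e. the continuous linear map from the symmetric tensors of the Hilbert tensor power $H^{\otimes n}$ to $L^2(\mathbb P)$ with $I_n(h^{\otimes n})=H_n(W(h))$ for $\|h\|_H=1$, where $H_n(x)=(-1)^n e^{x^2/2}\frac{d^n}{dx^n}e^{-x^2/2}$. Let $(f_t)_{0\le t\le1}$ be symmetric elements of $H^{\otimes n}$ and let $(X_t)_{0\le t\le 1}$ be a process with a.s. continuous paths such that $X_t=I_n(f_t)$ a.s. for every $t\in[0,1]$. Write $f_{s,t}=f_t-f_s$ and $X_{s,t}=X_t-X_s$, and let $\|\cdot\|$ be the norm of $H^{\otimes n}$. Assume: 1. (Regularity) $f_0=0$, and there are $C>0$ and $\theta>1$ with $0<\|f_{s,t}\|\le C|t-s|^{\theta/2}$ for all $0\le s<t\le1$. 2. (Kernel form) $0<\beta<1$,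 and for all $m\ge1$, $k,l\ge0$, all nonzero $(a_1,\dots,a_m)\in\mathbb R^m$, all $t_0<t_1<\dots<t_m$ in $[0,1]$, all $s_1<\dots<s_k$ in $[0,t_0)$ and all $r_1<\dots<r_l$ in $(t_m,1]$, the vector $v=\sum_{i=1}^m a_i f_{t_{i-1},t_i}$ satisfies $$\|v-Pv\|^2>\beta\|v\|^2,$$ where $P$ is the orthogonal projection onto the closed linear span of $f_{0,s_1},f_{s_1,s_2},\dots,f_{s_k,t_0},f_{t_m,r_1},f_{r_1,r_2},\dots,f_{r_{l-1},r_l}$ (for $k=0$ the first group is $f_{0,t_0}$; for $l=0$ the second group is empty). 3. (Non-negative row sums) $\langle f_{u,v},f_{s,t}\rangle_{H^{\otimes n}}\ge0$ whenever $[u,v]\subset[s,t]\subset[0,1]$. Let $\rho<\theta/2$, let $\tau>0$ with $\tau+\rho>1$, and let $g:[0,1]\to\mathbb R$ be (deterministic and) $\tau$-Hölder continuous with $$\|g\|_\tau=\sup_{s\ne t}\frac{|g(t)-g(s)|}{|t-s|^\tau}\neq0 .$$ Then, almost surely, the Young integral $\int_0^1 g_t\,dX_t$ (the limit of the tagged Riemann–Stieltjes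 sums as the mesh of the partition tends to $0$) exists, it belongs to $L^2(\mathbb P)$, and at least one of the following holds: $$\mathbb E\Big(\int_0^1 g_t\,dX_t\Big)^2\ \ge\ \frac{\beta}{4}\Big(\sup_{r\in[0,1]}|g_r|\Big)^2\,\mathbb E(X_1)^2,$$ or there is an interval $[a,b]\subset[0,1]$ with $$b-a\ \ge\ \Big(\frac{\sup_{r\in[0,1]}|g_r|}{2\|g\|_\tau}\Big)^{1/\tau} \qquad\text{and}\qquad \mathbb E\Big(\int_0^1 g_t\,dX_t\Big)^2\ \ge\ \frac{\beta}{4}\Big(\sup_{r\in[0,1]}|g_r|\Big)^2\,\mathbb E(X_{a,b})^2 .$$ Here $\mathbb E(Y)^2$ means $\mathbb E[Y^2]$. -/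

import Mathlib

open MeasureTheory ProbabilityTheory Filter Topology
open scoped NNReal ENNReal unitInterval TensorProduct

noncomputable section

/-! ### Hilbert tensor powers -/

/-- The algebraic `n`-th tensor power of a real vector space. (A type synonym, because the
algebraic tensor product already carries a different norm in Mathlib.) -/
def AlgTensorPower (H : Type*) [NormedAddCommGroup H] [InnerProductSpace ℝ H] (n : ℕ) : Type _ :=
  ⨂[ℝ] _ : Fin n, H

namespace AlgTensorPower

variable (H : Type*) [NormedAddCommGroup H] [InnerProductSpace ℝ H] (n : ℕ)

instance : AddCommGroup (AlgTensorPower H n) :=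
  inferInstanceAs (AddCommGroup (⨂[ℝ] _ : Fin n, H))

instance : Module ℝ (AlgTensorPower H n) :=
  inferInstanceAs (Module ℝ (⨂[ℝ] _ : Fin n, H))

/-- The pure tensor `x₁ ⊗ ⋯ ⊗ xₙ`, as a multilinear map. -/
def tprod : MultilinearMap ℝ (fun _ : Fin n => H) (AlgTensorPower H n) :=
  PiTensorProduct.tprod ℝ

/-- The bilinear form with `⟨x₁ ⊗ ⋯ ⊗ xₙ, y₁ ⊗ ⋯ ⊗ yₙ⟩ = ∏ᵢ ⟨xᵢ, yᵢ⟩`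
(see `form_tprod`). -/
def form : AlgTensorPower H n →ₗ[ℝ] AlgTensorPower H n →ₗ[ℝ] ℝ :=
  (PiTensorProduct.dualDistrib : (⨂[ℝ] _ : Fin n, Module.Dual ℝ H) →ₗ[ℝ]
    Module.Dual ℝ (⨂[ℝ] _ : Fin n, H)) ∘ₗ (PiTensorProduct.map fun _ : Fin n => innerₗ H)

variable {H n}

theorem form_tprod (x y : Fin n → H) :
    form H n (tprod H n x) (tprod H n y) = ∏ i, inner ℝ (x i) (y i) := by
  have h : ((PiTensorProduct.dualDistrib : (⨂[ℝ] _ : Fin n, Module.Dual ℝ H) →ₗ[ℝ]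
      Module.Dual ℝ (⨂[ℝ] _ : Fin n, H)) ∘ₗ (PiTensorProduct.map fun _ : Fin n => innerₗ H))
      (PiTensorProduct.tprod ℝ x) (PiTensorProduct.tprod ℝ y) = ∏ i, inner ℝ (x i) (y i) := by
    rw [LinearMap.comp_apply, PiTensorProduct.map_tprod, PiTensorProduct.dualDistrib_apply]
    rfl
  exact h

theorem span_tprod : Submodule.span ℝ (Set.range (tprod H n)) = ⊤ :=
  PiTensorProduct.span_tprod_eq_top

theorem form_symm (u v : AlgTensorPower H n) : form H n u v = form H n v u := by
  have key : form H n = (form H n).flip := by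
    apply LinearMap.ext_on_range (v := tprod H n) span_tprod
    intro x
    apply LinearMap.ext_on_range (v := tprod H n) span_tprod
    intro y
    rw [LinearMap.flip_apply, form_tprod, form_tprod]
    exact Finset.prod_congr rfl fun i _ => (real_inner_comm _ _)
  exact congrArg (fun B => B u v) key

theorem posSemidef_prod_gram {m : ℕ} (v : Fin m → Fin n → H) (s : Finset (Fin n)) :
    (Matrix.of fun i j : Fin m => ∏ k ∈ s, inner ℝ (v i k) (v j k)).PosSemidef := by
  classical
  induction s using Finset.induction_on with
  | empty =>
    have e : (Matrix.of fun i j : Fin m => ∏ k ∈ (∅ : Finset (Fin n)), inner ℝ (v i k) (v j k))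
        = Matrix.gram ℝ (fun _ : Fin m => (1 : ℝ)) := by
      ext i j
      simp [Matrix.gram]
    rw [e]
    exact Matrix.posSemidef_gram ℝ (fun _ : Fin m => (1 : ℝ))
  | insert a s ha ih =>
    have e : (Matrix.of fun i j : Fin m => ∏ k ∈ insert a s, inner ℝ (v i k) (v j k))
        = (Matrix.gram ℝ (fun i : Fin m => v i a)).hadamard
          (Matrix.of fun i j : Fin m => ∏ k ∈ s, inner ℝ (v i k) (v j k)) := by
      ext i j
      simp [Matrix.gram, Finset.prod_insert ha]
    rw [e]
    exact (Matrix.posSemidef_gram ℝ (fun i : Fin m => v i a)).hadamard ih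

theorem form_self_nonneg (u : AlgTensorPower H n) : 0 ≤ form H n u u := by
  have hu : u ∈ Submodule.span ℝ (Set.range (tprod H n)) := by rw [span_tprod]; trivial
  obtain ⟨m, c, w, rfl⟩ := Submodule.mem_span_set'.1 hu
  choose v hv using fun i => (w i).2
  have h := (Matrix.posSemidef_iff_dotProduct_mulVec.1
    (posSemidef_prod_gram v Finset.univ)).2 c
  have e : form H n (∑ i, c i • (w i : AlgTensorPower H n))
      (∑ i, c i • (w i : AlgTensorPower H n))
      = ∑ i, c i * ∑ j, (∏ k, inner ℝ (v i k) (v j k)) * c j := by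
    simp only [← hv, map_sum, map_smul, LinearMap.sum_apply, LinearMap.smul_apply, form_tprod,
      smul_eq_mul, Finset.mul_sum]
    rw [Finset.sum_comm]
    exact Finset.sum_congr rfl fun i _ => Finset.sum_congr rfl fun j _ => by ring
  rw [e]
  simpa [dotProduct, Matrix.mulVec] using h

variable (H n)

/-- The (pre-)inner product of the algebraic tensor power. -/
@[reducible]
def core : PreInnerProductSpace.Core ℝ (AlgTensorPower H n) where
  inner u v := form H n u v
  conj_inner_symm u v := form_symm v u
  re_inner_nonneg u := form_self_nonneg u
  add_left u v w := by simp
  smul_left u v r := by simp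

instance : SeminormedAddCommGroup (AlgTensorPower H n) :=
  @InnerProductSpace.Core.toSeminormedAddCommGroup ℝ _ _ _ _ (core H n)

instance : InnerProductSpace ℝ (AlgTensorPower H n) :=
  InnerProductSpace.ofCore (core H n)

end AlgTensorPower

/-- The Hilbert space `H^{⊗n}`: the completion of the algebraic tensor power with respect to
the inner product `⟨x₁ ⊗ ⋯ ⊗ xₙ, y₁ ⊗ ⋯ ⊗ yₙ⟩ = ∏ᵢ ⟨xᵢ, yᵢ⟩`. -/
abbrev HilbertTensorPower (H : Type*) [NormedAddCommGroup H] [InnerProductSpace ℝ H] (n : ℕ) :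
    Type _ :=
  UniformSpace.Completion (AlgTensorPower H n)

section Wiener

variable {H : Type*} [NormedAddCommGroup H] [InnerProductSpace ℝ H]

/-- The pure tensor `x₁ ⊗ ⋯ ⊗ xₙ` in `H^{⊗n}`. -/
def hilbertTprod {n : ℕ} (x : Fin n → H) : HilbertTensorPower H n :=
  ((AlgTensorPower.tprod H n x : AlgTensorPower H n) : HilbertTensorPower H n)

theorem inner_hilbertTprod {n : ℕ} (x y : Fin n → H) :
    inner ℝ (hilbertTprod x) (hilbertTprod y) = ∏ i, inner ℝ (x i) (y i) := by
  unfold hilbertTprod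
  rw [UniformSpace.Completion.inner_coe]
  exact AlgTensorPower.form_tprod x y

/-! ### Isonormal Gaussian processes and multiple Wiener–Itô integrals -/

variable {Ω : Type*} [MeasurableSpace Ω]

/-- `W` is an isonormal Gaussian process over `H`: a centered (jointly) Gaussian family indexed
by `H` with `E[W(h) W(g)] = ⟨h, g⟩`. -/
structure IsIsonormalGaussian (W : H → Ω → ℝ) (P : Measure Ω) : Prop where
  isGaussianProcess : IsGaussianProcess W P
  centered : ∀ h, ∫ ω, W h ω ∂P = 0
  covariance : ∀ h g, ∫ ω, W h ω * W g ω ∂P = inner ℝ h g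

/-- The graph of the multiple Wiener–Itô integral `Iₙ`. On the tensors `h^{⊗n}` with `‖h‖ = 1`,
`Iₙ(h^{⊗n}) = Hₙ(W(h))` with `Hₙ` the `n`-th (probabilists') Hermite polynomial; `Iₙ` is extended
by linearity and `L²`-convergence. Its domain is the closed linear span of the `h^{⊗n}`,
that is, the space of symmetric tensors. -/
def multipleIntegralGraph (W : H → Ω → ℝ) (P : Measure Ω) (n : ℕ) :
    Submodule ℝ (HilbertTensorPower H n × Lp ℝ 2 P) :=
  (Submodule.span ℝ {p : HilbertTensorPower H n × Lp ℝ 2 P |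
    ∃ h : H, ‖h‖ = 1 ∧ p.1 = hilbertTprod (fun _ : Fin n => h) ∧
      p.2 =ᵐ[P] fun ω => Polynomial.aeval (W h ω) (Polynomial.hermite n)}).topologicalClosure

/-- `Y = Iₙ(f)` almost surely (so `f` is symmetric, and `Y` is square integrable). -/
def IsMultipleIntegral (W : H → Ω → ℝ) (P : Measure Ω) (n : ℕ) (f : HilbertTensorPower H n)
    (Y : Ω → ℝ) : Prop :=
  ∃ hY : MemLp Y 2 P, (f, hY.toLp Y) ∈ multipleIntegralGraph W P n

end Wiener

/-! ### Assumptions on the kernels -/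

section Kernel

variable {E : Type*} [NormedAddCommGroup E] [InnerProductSpace ℝ E]

/-- Regularity of the kernels, with exponent `θ`. -/
def KernelRegularity (f : I → E) (θ : ℝ) : Prop :=
  1 < θ ∧ f 0 = 0 ∧ ∃ C : ℝ, 0 < C ∧ ∀ s t : I, s < t →
    0 < ‖f t - f s‖ ∧ ‖f t - f s‖ ≤ C * ((t : ℝ) - s) ^ (θ / 2)

/-- The increments `f_{p₀,p₁}, …, f_{p_{k-1},p_k}` of `f` along `p₀, …, p_k`. -/
def incrementsAlong (f : I → E) {k : ℕ} (p : Fin (k + 1) → I) : Set E :=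
  Set.range fun i : Fin k => f (p i.succ) - f (p i.castSucc)

/-- The span of `f_{0,s₁}, …, f_{s_k,u}` and `f_{v,r₁}, …, f_{r_{l-1},r_l}`. -/
def outerSpan (f : I → E) {k l : ℕ} (s : Fin k → I) (u v : I) (r : Fin l → I) :
    Submodule ℝ E :=
  Submodule.span ℝ
    (incrementsAlong f (Fin.cons 0 (Fin.snoc s u : Fin (k + 1) → I) : Fin (k + 2) → I) ∪
      incrementsAlong f (Fin.cons v r : Fin (l + 1) → I))

/-- The kernel form of the non-determinism condition, with constant `β`: a nontrivial linear
combination of the increments over `t₀ < ⋯ < t_m` keeps a fraction larger than `β` of its squared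
norm after subtracting its projection onto the closed span of increments outside `[t₀, t_m]`. -/
def KernelForm [CompleteSpace E] (f : I → E) (β : ℝ) : Prop :=
  ∀ (m k l : ℕ) (a : Fin m → ℝ) (t : Fin (m + 1) → I) (s : Fin k → I) (r : Fin l → I),
    a ≠ 0 → StrictMono t → StrictMono s → StrictMono r →
    (∀ i, s i < t 0) → (∀ i, t (Fin.last m) < r i) →
    β * ‖∑ i, a i • (f (t i.succ) - f (t i.castSucc))‖ ^ 2 <
      ‖(∑ i, a i • (f (t i.succ) - f (t i.castSucc))) -
        (outerSpan f s (t 0) (t (Fin.last m)) r).topologicalClosure.starProjection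
          (∑ i, a i • (f (t i.succ) - f (t i.castSucc)))‖ ^ 2

/-- `⟨f_v - f_u, f_t - f_s⟩ ≥ 0` whenever `[u, v] ⊆ [s, t] ⊆ [0, 1]`. -/
def NonnegRowSum (f : I → E) : Prop :=
  ∀ s u v t : I, s ≤ u → u ≤ v → v ≤ t → 0 ≤ inner ℝ (f v - f u) (f t - f s)

end Kernel

/-! ### The Young integral -/

/-- `J = ∫₀¹ g dx` as a Young integral: the tagged Riemann–Stieltjes sums
`∑ g(ξᵢ) (x(tᵢ₊₁) - x(tᵢ))`, `tᵢ ≤ ξᵢ ≤ tᵢ₊₁`, over partitions of `[0, 1]` converge to `J` as the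
mesh tends to `0`. -/
def HasYoungIntegral (g x : I → ℝ) (J : ℝ) : Prop :=
  ∀ ε > 0, ∃ δ > 0, ∀ (N : ℕ) (t : Fin (N + 1) → I) (ξ : Fin N → I),
    Monotone t → t 0 = 0 → t (Fin.last N) = 1 →
    (∀ i : Fin N, t i.castSucc ≤ ξ i ∧ ξ i ≤ t i.succ) →
    (∀ i : Fin N, (t i.succ : ℝ) - t i.castSucc < δ) →
    |(∑ i : Fin N, g (ξ i) * (x (t i.succ) - x (t i.castSucc))) - J| < ε

open Classical in
/-- The Young integral `∫₀¹ g dx` (`0` if it does not exist). -/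
def youngIntegral (g x : I → ℝ) : ℝ :=
  if h : ∃ J, HasYoungIntegral g x J then h.choose else 0

end

/-! Up to a constant the problem lives in the kernel space. For unit vectors write `k = c • h + z`
with `z ⟂ h`: then `W z` is independent of `W h`, and Mehler's formula gives `E[Hₙ(W h) Hₙ(W k)] = κ
⟨h, k⟩ⁿ` with `κ = E[Hₙ(N)²]`, `N` standard normal. By bilinearity and closure `Iₙ` multiplies
squared norms by `κ` (`IsIsonormalGaussian.norm_sq_eq_of_mem_graph`). Hence the second moment of the
integral is `κ ‖Z‖²`, where `Z` is the limit of the dyadic sums of `g` against `f`; this limit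
exists by Young's estimate in norm (`cauchySeq_vectorDyadicSum`).

The lower bound on `‖Z‖` is `KernelForm.interpolation`. Let `G = sup |g|`, attained at `r`, say with
`g r = G`. Either `g ≥ G / 2` on all of `[0, 1]`, or the Hölder bound keeps `g ≥ G / 2` on an
interval of the required length with endpoint `r`. In a dyadic sum, the increments outside this
interval cannot bring the squared norm below `β` times that of the block inside
(`KernelForm.mul_norm_sq_le`). Non-negative row sums allow the weights in the block to be lowered to
`G / 2` without increasing the norm (`mul_norm_sum_sq_le`), after which the block telescopes. The
constant is `β (1 / 2)² = β / 4`.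

Pathwise existence uses second moments only. On their own these give, by Kolmogorov's criterion,
Hölder exponents below `(θ - 1) / 2`, too small in general. Instead, the squared dyadic increments,
weighted by `2 ^ (γ n)`, have a summable expectation whenever `γ + 1 < θ` (`ae_finiteDyadicEnergy`).
Chaining bounds an increment over `[s, t]` by `(t - s) ^ (γ / 2)` times the square root of the
energy on `[s, t]` (`FiniteDyadicEnergy.abs_sub_le`). Since energy is superadditive, length plus
energy is a control whose power `(γ + 1) / 2` bounds increments, and this exponent can be taken as
close to `θ / 2` as desired; the Young–Loève argument then applies. The pathwise integral and the
`L²` limit agree because `L²` convergence gives almost sure convergence along a subsequence. -/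

noncomputable section

/-! ### A Young–Loève estimate -/

/-- Summing an almost additive two-parameter family along consecutive indices: the error is
controlled by a power `a > 1` of a superadditive control. -/
theorem abs_sum_Ico_sub_le_of_superadditive {Ξ Ω : ℕ → ℕ → ℝ} {M : ℕ} {K a : ℝ} (ha : 1 < a)
    (hK : 0 ≤ K) (h0 : ∀ p, Ξ p p = 0) (hΩ0 : ∀ p, Ω p p = 0) (hΩ' : ∀ p q, p ≤ q → 0 ≤ Ω p q)
    (hsup : ∀ p r q, p ≤ r → r ≤ q → Ω p r + Ω r q ≤ Ω p q)
    (hdef : ∀ p r q, p ≤ r → r ≤ q → q ≤ M → |Ξ p q - Ξ p r - Ξ r q| ≤ K * Ω p q ^ a) :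
    ∀ d p q, q = p + d → q ≤ M →
      |∑ k ∈ Finset.Ico p q, Ξ k (k + 1) - Ξ p q| ≤
        2 * K / (1 - 2 ^ (1 - a)) * Ω p q ^ a := by
  have h2 : (2 : ℝ) ^ (1 - a) < 1 := Real.rpow_lt_one_of_one_lt_of_neg (by norm_num) (by linarith)
  set C := 2 * K / (1 - (2 : ℝ) ^ (1 - a)) with hC
  have hC0 : 0 ≤ C := div_nonneg (by linarith) (by linarith)
  -- `C` is the fixed point of the recursion: two halves contribute `2 C (Ω / 2) ^ a = C 2 ^ (1 - a)
  -- Ω ^ a`, and two defects contribute `2 K Ω ^ a`.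
  have hCeq : C * 2 ^ (1 - a) + 2 * K = C := by
    have : C * (1 - 2 ^ (1 - a)) = 2 * K := by
      rw [hC]; exact div_mul_cancel₀ _ (by linarith)
    linarith
  intro d
  induction d using Nat.strong_induction_on with
  | _ d ih =>
    intro p q hq hqM
    rcases Nat.eq_zero_or_pos d with rfl | hd
    · subst hq
      simpa [h0, hΩ0] using mul_nonneg hC0 (Real.rpow_nonneg le_rfl a)
    -- Split around the first step `j → j + 1` that carries the control from `p` past half of its
    -- total, or around the last step if none does. Minimality bounds the control before `j` by one
    -- half; superadditivity bounds that after `j + 1`.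
    · have hex : ∃ j, p ≤ j ∧ (j + 1 = q ∨ Ω p q / 2 < Ω p (j + 1)) :=
        ⟨q - 1, by omega, Or.inl (by omega)⟩
      classical
      obtain ⟨hpj, hj⟩ := Nat.find_spec hex
      have hmin : ∀ m < Nat.find hex, ¬ (p ≤ m ∧ (m + 1 = q ∨ Ω p q / 2 < Ω p (m + 1))) :=
        fun m hm => Nat.find_min hex hm
      have hjq : Nat.find hex ≤ q - 1 :=
        Nat.find_min' hex ⟨by omega, Or.inl (by omega)⟩
      generalize Nat.find hex = j at *
      have hΩ : 0 ≤ Ω p q ∧ 0 ≤ Ω p j ∧ 0 ≤ Ω j q ∧ 0 ≤ Ω (j + 1) q :=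
        ⟨hΩ' _ _ (by omega), hΩ' _ _ (by omega), hΩ' _ _ (by omega), hΩ' _ _ (by omega)⟩
      have hl : Ω p j ≤ Ω p q / 2 := by
        rcases hpj.eq_or_lt with rfl | h
        · rw [hΩ0]; linarith [hΩ.1]
        · have := hmin (j - 1) (by omega)
          rw [show j - 1 + 1 = j by omega] at this
          by_contra hcon
          exact this ⟨by omega, Or.inr (not_le.1 hcon)⟩
      have hr : Ω (j + 1) q ≤ Ω p q / 2 := by
        rcases hj with h | h
        · rw [h, hΩ0]; linarith [hΩ.1]
        · linarith [hsup p (j + 1) q (by omega) (by omega)]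
      have e1 := ih (j - p) (by omega) p j (by omega) (by omega)
      have e2 := ih (q - (j + 1)) (by omega) (j + 1) q (by omega) (by omega)
      have d1 := hdef p j q hpj (by omega) hqM
      have d2 := hdef j (j + 1) q (by omega) (by omega) hqM
      have hjq' : Ω j q ≤ Ω p q := by linarith [hsup p j q hpj (by omega), hΩ.2.1]
      have hp2 : Ω j q ^ a ≤ Ω p q ^ a := Real.rpow_le_rpow hΩ.2.2.1 hjq' (by linarith)
      have hhalf : ∀ y, 0 ≤ y → y ≤ Ω p q / 2 → C * y ^ a ≤ C * (2 ^ (1 - a) / 2 * Ω p q ^ a) := by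
        intro y hy0 hy
        refine mul_le_mul_of_nonneg_left ?_ hC0
        calc y ^ a ≤ (Ω p q / 2) ^ a := Real.rpow_le_rpow hy0 hy (by linarith)
          _ = 2 ^ (1 - a) / 2 * Ω p q ^ a := by
            rw [Real.div_rpow hΩ.1 (by norm_num), Real.rpow_sub (by norm_num), Real.rpow_one]
            ring
      have b1 := hhalf _ hΩ.2.1 hl
      have b2 := hhalf _ hΩ.2.2.2 hr
      have b3 : K * Ω j q ^ a ≤ K * Ω p q ^ a := mul_le_mul_of_nonneg_left hp2 hK
      have hsplit : ∑ k ∈ Finset.Ico p q, Ξ k (k + 1) = ∑ k ∈ Finset.Ico p j, Ξ k (k + 1)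
          + Ξ j (j + 1) + ∑ k ∈ Finset.Ico (j + 1) q, Ξ k (k + 1) := by
        rw [← Finset.sum_Ico_consecutive _ hpj (by omega : j ≤ q),
          Finset.sum_eq_sum_Ico_succ_bot (by omega : j < q)]
        ring
      have hfin : C * Ω p q ^ a = C * 2 ^ (1 - a) * Ω p q ^ a + 2 * K * Ω p q ^ a := by
        rw [← add_mul, hCeq]
      rw [hsplit, hfin]
      rw [abs_le] at *
      constructor <;> nlinarith

/-! ### Dyadic energy of a path -/

/-- The sum of the squared increments over the dyadic intervals of level `n` inside `[s, t]`. -/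
def dyadicEnergyAt (x : ℝ → ℝ) (n : ℕ) (s t : ℝ) : ℝ :=
  ∑ k ∈ Finset.range (2 ^ n), if s ≤ k / 2 ^ n ∧ ((k : ℝ) + 1) / 2 ^ n ≤ t then
    (x (((k : ℝ) + 1) / 2 ^ n) - x (k / 2 ^ n)) ^ 2 else 0

/-- The sum of the squared increments over all dyadic intervals of level `n` in `[0, 1]`. -/
def dyadicVariation (x : ℝ → ℝ) (n : ℕ) : ℝ :=
  ∑ k ∈ Finset.range (2 ^ n), (x (((k : ℝ) + 1) / 2 ^ n) - x (k / 2 ^ n)) ^ 2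

/-- The dyadic energy of `x` on `[s, t]`, where level `n` has weight `2 ^ (γ n)`. -/
def dyadicEnergy (γ : ℝ) (x : ℝ → ℝ) (s t : ℝ) : ℝ :=
  ∑' n, ((2 : ℝ) ^ γ) ^ n * dyadicEnergyAt x n s t

/-- The path `x` has finite dyadic energy on `[0, 1]`. -/
def FiniteDyadicEnergy (γ : ℝ) (x : ℝ → ℝ) : Prop :=
  Summable fun n : ℕ => ((2 : ℝ) ^ γ) ^ n * dyadicVariation x n

theorem dyadicEnergyAt_nonneg (x : ℝ → ℝ) (n : ℕ) (s t : ℝ) : 0 ≤ dyadicEnergyAt x n s t :=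
  Finset.sum_nonneg fun k _ => by split_ifs <;> positivity

theorem dyadicEnergyAt_le (x : ℝ → ℝ) (n : ℕ) (s t : ℝ) : dyadicEnergyAt x n s t ≤
    dyadicVariation x n :=
  Finset.sum_le_sum fun k _ => by split_ifs <;> first | rfl | positivity

/-- A dyadic interval has positive length, so it cannot lie in both pieces; those straddling `u`
count only on the right. -/
theorem dyadicEnergyAt_add_le (x : ℝ → ℝ) (n : ℕ) {s u t : ℝ} (hsu : s ≤ u) (hut : u ≤ t) :
    dyadicEnergyAt x n s u + dyadicEnergyAt x n u t ≤ dyadicEnergyAt x n s t := by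
  unfold dyadicEnergyAt
  rw [← Finset.sum_add_distrib]
  refine Finset.sum_le_sum fun k _ => ?_
  have hlt : (k : ℝ) / 2 ^ n < ((k : ℝ) + 1) / 2 ^ n := by gcongr; linarith
  have hsq := sq_nonneg (x (((k : ℝ) + 1) / 2 ^ n) - x (k / 2 ^ n))
  by_cases h1 : s ≤ k / 2 ^ n ∧ ((k : ℝ) + 1) / 2 ^ n ≤ u
  · rw [if_pos h1, if_neg (fun h => by linarith [h1.2, h.1]), if_pos ⟨h1.1, h1.2.trans hut⟩,
      add_zero]
  · rw [if_neg h1, zero_add]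
    by_cases h2 : u ≤ k / 2 ^ n ∧ ((k : ℝ) + 1) / 2 ^ n ≤ t
    · rw [if_pos h2, if_pos ⟨hsu.trans h2.1, h2.2⟩]
    · rw [if_neg h2]; split_ifs <;> positivity

theorem dyadicEnergyAt_eq_zero (x : ℝ → ℝ) {n : ℕ} {s t : ℝ} (h : t - s < 1 / 2 ^ n) :
    dyadicEnergyAt x n s t = 0 := by
  refine Finset.sum_eq_zero fun k _ => if_neg fun hk => ?_
  have : ((k : ℝ) + 1) / 2 ^ n = k / 2 ^ n + 1 / 2 ^ n := by ring
  linarith [hk.1, hk.2]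

theorem dyadicEnergy_nonneg (γ : ℝ) (x : ℝ → ℝ) (s t : ℝ) : 0 ≤ dyadicEnergy γ x s t :=
  tsum_nonneg fun n => mul_nonneg (by positivity) (dyadicEnergyAt_nonneg x n s t)

theorem dyadicEnergy_self (γ : ℝ) (x : ℝ → ℝ) (s : ℝ) : dyadicEnergy γ x s s = 0 := by
  have h : ∀ n, dyadicEnergyAt x n s s = 0 := fun n => dyadicEnergyAt_eq_zero x (by simp)
  simp [dyadicEnergy, h]

section

variable {γ : ℝ} {x : ℝ → ℝ}

theorem FiniteDyadicEnergy.summable (hx : FiniteDyadicEnergy γ x) (s t : ℝ) :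
    Summable fun n : ℕ => ((2 : ℝ) ^ γ) ^ n * dyadicEnergyAt x n s t :=
  Summable.of_nonneg_of_le
    (fun n => mul_nonneg (by positivity) (dyadicEnergyAt_nonneg x n s t))
    (fun n => mul_le_mul_of_nonneg_left (dyadicEnergyAt_le x n s t) (by positivity)) hx

theorem FiniteDyadicEnergy.add_le (hx : FiniteDyadicEnergy γ x) {s u t : ℝ} (hsu : s ≤ u)
    (hut : u ≤ t) : dyadicEnergy γ x s u + dyadicEnergy γ x u t ≤ dyadicEnergy γ x s t := by
  unfold dyadicEnergy
  rw [← (hx.summable s u).tsum_add (hx.summable u t)]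
  refine ((hx.summable s u).add (hx.summable u t)).tsum_le_tsum (fun n => ?_) (hx.summable s t)
  rw [← mul_add]
  exact mul_le_mul_of_nonneg_left (dyadicEnergyAt_add_le x n hsu hut) (by positivity)

/-- A short interval contains no dyadic interval of low level, so only a tail of the series remains,
and the energy series of `[0, 1]` dominates that tail uniformly in the position. -/
theorem FiniteDyadicEnergy.exists_lt (hx : FiniteDyadicEnergy γ x) {η : ℝ} (hη : 0 < η) :
    ∃ δ > 0, ∀ s t, t - s < δ → dyadicEnergy γ x s t < η := by
  -- The index `N` depends on the majorant `u` alone; this is what makes `δ` uniform in `s` and `t`.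
  have key : ∀ u : ℕ → ℝ, Summable u → ∃ N, ∀ v : ℕ → ℝ, Summable v → (∀ n, v n ≤ u n) →
      ∑' i, v (i + N) < η := fun u hu =>
    ((tendsto_sum_nat_add u).eventually (gt_mem_nhds hη)).exists.imp fun N hN v hv hvu =>
      lt_of_le_of_lt (Summable.tsum_le_tsum (fun n => hvu _) ((summable_nat_add_iff N).2 hv)
        ((summable_nat_add_iff N).2 hu)) hN
  obtain ⟨N, hN⟩ := key _ hx
  refine ⟨1 / 2 ^ N, by positivity, fun s t hst => ?_⟩
  have h0 : ∑ n ∈ Finset.range N, ((2 : ℝ) ^ γ) ^ n * dyadicEnergyAt x n s t = 0 := by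
    refine Finset.sum_eq_zero fun n hn => ?_
    rw [dyadicEnergyAt_eq_zero, mul_zero]
    refine hst.trans_le (one_div_le_one_div_of_le (by positivity) ?_)
    exact pow_le_pow_right₀ (by norm_num) (Finset.mem_range.1 hn).le
  have h1 := (hx.summable s t).sum_add_tsum_nat_add N
  rw [h0, zero_add] at h1
  rw [dyadicEnergy, ← h1]
  exact hN _ (hx.summable s t) fun n =>
    mul_le_mul_of_nonneg_left (dyadicEnergyAt_le x n s t) (by positivity)

/-- The squared increment, times its weight, is a single term of a non-negative series. -/
theorem FiniteDyadicEnergy.abs_dyadic_le (hx : FiniteDyadicEnergy γ x) {s t : ℝ} {n k : ℕ}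
    (hk : k < 2 ^ n) (hs : s ≤ k / 2 ^ n) (ht : ((k : ℝ) + 1) / 2 ^ n ≤ t) :
    |x (((k : ℝ) + 1) / 2 ^ n) - x (k / 2 ^ n)| ≤
      ((2 : ℝ) ^ (-(γ / 2))) ^ n * √(dyadicEnergy γ x s t) := by
  set d := x (((k : ℝ) + 1) / 2 ^ n) - x (k / 2 ^ n) with hd
  have h1 : d ^ 2 ≤ dyadicEnergyAt x n s t := by
    have h := Finset.single_le_sum (f := fun k : ℕ => if s ≤ k / 2 ^ n ∧
      ((k : ℝ) + 1) / 2 ^ n ≤ t then (x (((k : ℝ) + 1) / 2 ^ n) - x (k / 2 ^ n)) ^ 2 else 0)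
      (fun k _ => by split_ifs <;> positivity) (Finset.mem_range.2 hk)
    rwa [if_pos (And.intro hs ht)] at h
  have h2 : ((2 : ℝ) ^ γ) ^ n * dyadicEnergyAt x n s t ≤ dyadicEnergy γ x s t :=
    (hx.summable s t).le_tsum n fun m _ =>
      mul_nonneg (by positivity) (dyadicEnergyAt_nonneg x m s t)
  have hq : (((2 : ℝ) ^ (-(γ / 2))) ^ n) ^ 2 * ((2 : ℝ) ^ γ) ^ n = 1 := by
    rw [← pow_mul, mul_comm n 2, pow_mul, ← mul_pow, ← Real.rpow_natCast (_ ^ (-(γ / 2))) 2,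
      ← Real.rpow_mul (by norm_num), ← Real.rpow_add (by norm_num)]
    rw [show -(γ / 2) * ((2 : ℕ) : ℝ) + γ = 0 by push_cast; ring, Real.rpow_zero, one_pow]
  have h3 : d ^ 2 ≤ (((2 : ℝ) ^ (-(γ / 2))) ^ n) ^ 2 * dyadicEnergy γ x s t := by
    calc d ^ 2 ≤ dyadicEnergyAt x n s t := h1
      _ = (((2 : ℝ) ^ (-(γ / 2))) ^ n) ^ 2 * (((2 : ℝ) ^ γ) ^ n * dyadicEnergyAt x n s t) := by
        rw [← mul_assoc, hq, one_mul]
      _ ≤ _ := mul_le_mul_of_nonneg_left h2 (by positivity)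
  calc |d| ≤ √((((2 : ℝ) ^ (-(γ / 2))) ^ n) ^ 2 * dyadicEnergy γ x s t) := Real.abs_le_sqrt h3
    _ = _ := by rw [Real.sqrt_mul (by positivity), Real.sqrt_sq (by positivity)]

/-! ### Chaining: from dyadic energy to increments -/

theorem tendsto_floor_dyadic {s : ℝ} (hs : 0 ≤ s) :
    Tendsto (fun n : ℕ => (⌊s * 2 ^ n⌋₊ : ℝ) / 2 ^ n) atTop (𝓝 s) :=
  (tendsto_nat_floor_mul_div_atTop hs).comp (tendsto_pow_atTop_atTop_of_one_lt (by norm_num))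

theorem tendsto_ceil_dyadic {s : ℝ} (hs : 0 ≤ s) :
    Tendsto (fun n : ℕ => (⌈s * 2 ^ n⌉₊ : ℝ) / 2 ^ n) atTop (𝓝 s) :=
  (tendsto_nat_ceil_mul_div_atTop hs).comp (tendsto_pow_atTop_atTop_of_one_lt (by norm_num))

section

variable {γ : ℝ} {x : ℝ → ℝ}

/-- Finite dyadic energy bounds the increments of a continuous path. -/
theorem FiniteDyadicEnergy.abs_sub_le (hx : FiniteDyadicEnergy γ x) (hγ : 0 < γ)
    (hc : Continuous x) {s t : ℝ} (hs : 0 ≤ s) (hst : s < t) (ht : t ≤ 1) :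
    |x t - x s| ≤ 2 / (1 - 2 ^ (-(γ / 2))) * ((t - s) ^ (γ / 2) * √(dyadicEnergy γ x s t)) := by
  set q : ℝ := 2 ^ (-(γ / 2)) with hq
  have hq0 : 0 < q := by positivity
  have hq1 : q < 1 := Real.rpow_lt_one_of_one_lt_of_neg (by norm_num) (by linarith)
  set A := √(dyadicEnergy γ x s t) with hA
  have hA0 : 0 ≤ A := Real.sqrt_nonneg _
  -- Level `m + 1` is the scale of the interval: `2 ^ (-(m + 1)) < t - s ≤ 2 ^ (-m)`.
  obtain ⟨m, hm1, hm2⟩ := exists_nat_pow_near_of_lt_one (sub_pos.2 hst) (by linarith : t - s ≤ 1)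
    (by norm_num : (0 : ℝ) < 1 / 2) (by norm_num)
  have ht0 : 0 ≤ t := by linarith
  have hceil : ∀ j : ℕ, (⌈s * 2 ^ j⌉₊ : ℝ) < s * 2 ^ j + 1 :=
    fun j => Nat.ceil_lt_add_one (by positivity)
  have hceil' : ∀ j : ℕ, s * 2 ^ j ≤ (⌈s * 2 ^ j⌉₊ : ℝ) := fun j => Nat.le_ceil _
  have hfloor : ∀ j : ℕ, (⌊t * 2 ^ j⌋₊ : ℝ) ≤ t * 2 ^ j := fun j => Nat.floor_le (by positivity)
  have hfloor' : ∀ j : ℕ, t * 2 ^ j < (⌊t * 2 ^ j⌋₊ : ℝ) + 1 := fun j => Nat.lt_floor_add_one _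
  -- From this level on the grid meets `[s, t]`. Rounding `s` up and `t` down keeps the whole chain
  -- inside, so that only the energy of `[s, t]` is spent.
  have hcf : ∀ j, m + 1 ≤ j → ⌈s * 2 ^ j⌉₊ ≤ ⌊t * 2 ^ j⌋₊ := by
    intro j hj
    have h1 : (1 : ℝ) ≤ (t - s) * 2 ^ j := by
      have h3 : (1 / 2 : ℝ) ^ j ≤ (1 / 2) ^ (m + 1) :=
        pow_le_pow_of_le_one (by norm_num) (by norm_num) hj
      have h2 : (1 / 2 : ℝ) ^ j * 2 ^ j = 1 := by rw [← mul_pow]; norm_num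
      rw [← h2]
      exact mul_le_mul_of_nonneg_right (by linarith) (by positivity)
    have h2 : (⌈s * 2 ^ j⌉₊ : ℝ) < (⌊t * 2 ^ j⌋₊ : ℝ) + 1 := by
      linarith [hceil j, hfloor' j]
    have h3 : ⌈s * 2 ^ j⌉₊ < ⌊t * 2 ^ j⌋₊ + 1 := by exact_mod_cast h2
    omega
  -- increments over one dyadic interval inside `[s, t]`
  have hstep : ∀ j k : ℕ, ⌈s * 2 ^ j⌉₊ ≤ k → k + 1 ≤ ⌊t * 2 ^ j⌋₊ →
      |x (((k + 1 : ℕ) : ℝ) / 2 ^ j) - x ((k : ℝ) / 2 ^ j)| ≤ q ^ j * A := by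
    intro j k h1 h2
    have h1' : (⌈s * 2 ^ j⌉₊ : ℝ) ≤ k := by exact_mod_cast h1
    have h2' : (k : ℝ) + 1 ≤ (⌊t * 2 ^ j⌋₊ : ℝ) := by exact_mod_cast h2
    have hp : (0 : ℝ) < 2 ^ j := by positivity
    have hk : (k : ℝ) < 2 ^ j := by nlinarith [hfloor j]
    rw [Nat.cast_add_one]
    refine hx.abs_dyadic_le (by exact_mod_cast hk) ?_ ?_
    · rw [le_div_iff₀ hp]; linarith [hceil' j]
    · rw [div_le_iff₀ hp]; linarith [hfloor j]
  have hpp : ∀ j : ℕ, (2 : ℝ) ^ (j + 1) = 2 * 2 ^ j := fun j => by ring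
  have hdouble : ∀ j k : ℕ, (k : ℝ) / 2 ^ j = ((2 * k : ℕ) : ℝ) / 2 ^ (j + 1) := fun j k => by
    rw [hpp, Nat.cast_mul, Nat.cast_ofNat, mul_div_mul_left _ _ (by norm_num)]
  -- Refining the grid by one level moves the rounded endpoint by at most one interval of the finer
  -- level, so the chain down to `s` is dominated by a geometric series of ratio `q`.
  have hlow : |x ((⌈s * 2 ^ (m + 1)⌉₊ : ℝ) / 2 ^ (m + 1)) - x s| ≤ q ^ (m + 2) * A / (1 - q) := by
    have ht1 : Tendsto (fun j : ℕ => x ((⌈s * 2 ^ (m + 1 + j)⌉₊ : ℝ) / 2 ^ (m + 1 + j))) atTop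
        (𝓝 (x s)) := by
      refine (hc.tendsto s).comp ?_
      simpa only [add_comm] using (tendsto_add_atTop_iff_nat (m + 1)).2 (tendsto_ceil_dyadic hs)
    have h := dist_le_of_le_geometric_of_tendsto₀ q (q ^ (m + 2) * A) hq1 (fun j => ?_) ht1
    · simpa [Real.dist_eq] using h
    · have e : m + 1 + (j + 1) = m + 1 + j + 1 := by ring
      rw [e, Real.dist_eq, show q ^ (m + 2) * A * q ^ j = q ^ (m + 1 + j + 1) * A by ring,
        hdouble (m + 1 + j)]
      have c1 := hcf (m + 1 + j) (by omega)
      have c2 := hcf (m + 1 + j + 1) (by omega)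
      have c3 : ⌈s * 2 ^ (m + 1 + j + 1)⌉₊ ≤ 2 * ⌈s * 2 ^ (m + 1 + j)⌉₊ := by
        refine Nat.ceil_le.2 ?_
        push_cast
        rw [hpp]; linarith [hceil' (m + 1 + j)]
      have c4 : 2 * ⌈s * 2 ^ (m + 1 + j)⌉₊ < ⌈s * 2 ^ (m + 1 + j + 1)⌉₊ + 2 := by
        have := hceil' (m + 1 + j + 1)
        rw [hpp (m + 1 + j)] at this
        have h5 : (2 * ⌈s * 2 ^ (m + 1 + j)⌉₊ : ℝ) < ⌈s * (2 * 2 ^ (m + 1 + j))⌉₊ + 2 := by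
          linarith [hceil (m + 1 + j)]
        rw [hpp (m + 1 + j)]
        exact_mod_cast h5
      have c5 : 2 * ⌊t * 2 ^ (m + 1 + j)⌋₊ ≤ ⌊t * 2 ^ (m + 1 + j + 1)⌋₊ := by
        refine Nat.le_floor ?_
        push_cast
        rw [hpp]; linarith [hfloor (m + 1 + j)]
      rcases c3.eq_or_lt with h | h
      · rw [h]; simp; positivity
      · have e2 : 2 * ⌈s * 2 ^ (m + 1 + j)⌉₊ = ⌈s * 2 ^ (m + 1 + j + 1)⌉₊ + 1 := by omega
        rw [e2]
        exact hstep _ _ le_rfl (by omega)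
  have hhigh : |x ((⌊t * 2 ^ (m + 1)⌋₊ : ℝ) / 2 ^ (m + 1)) - x t| ≤ q ^ (m + 2) * A / (1 - q) := by
    have ht1 : Tendsto (fun j : ℕ => x ((⌊t * 2 ^ (m + 1 + j)⌋₊ : ℝ) / 2 ^ (m + 1 + j))) atTop
        (𝓝 (x t)) := by
      refine (hc.tendsto t).comp ?_
      simpa only [add_comm] using (tendsto_add_atTop_iff_nat (m + 1)).2 (tendsto_floor_dyadic ht0)
    have h := dist_le_of_le_geometric_of_tendsto₀ q (q ^ (m + 2) * A) hq1 (fun j => ?_) ht1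
    · simpa [Real.dist_eq] using h
    · have e : m + 1 + (j + 1) = m + 1 + j + 1 := by ring
      rw [e, Real.dist_eq, show q ^ (m + 2) * A * q ^ j = q ^ (m + 1 + j + 1) * A by ring,
        hdouble (m + 1 + j), abs_sub_comm]
      have c1 := hcf (m + 1 + j) (by omega)
      have c2 := hcf (m + 1 + j + 1) (by omega)
      have c3 : 2 * ⌊t * 2 ^ (m + 1 + j)⌋₊ ≤ ⌊t * 2 ^ (m + 1 + j + 1)⌋₊ := by
        refine Nat.le_floor ?_
        push_cast
        rw [hpp]; linarith [hfloor (m + 1 + j)]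
      have c4 : ⌊t * 2 ^ (m + 1 + j + 1)⌋₊ < 2 * ⌊t * 2 ^ (m + 1 + j)⌋₊ + 2 := by
        have := hfloor (m + 1 + j + 1)
        rw [hpp (m + 1 + j)] at this
        have h5 : (⌊t * (2 * 2 ^ (m + 1 + j))⌋₊ : ℝ) < 2 * ⌊t * 2 ^ (m + 1 + j)⌋₊ + 2 := by
          linarith [hfloor' (m + 1 + j)]
        rw [hpp (m + 1 + j)]
        exact_mod_cast h5
      have c5 : ⌈s * 2 ^ (m + 1 + j + 1)⌉₊ ≤ 2 * ⌈s * 2 ^ (m + 1 + j)⌉₊ := by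
        refine Nat.ceil_le.2 ?_
        push_cast
        rw [hpp]; linarith [hceil' (m + 1 + j)]
      rcases c3.eq_or_lt with h | h
      · rw [← h]; simp; positivity
      · have e2 : ⌊t * 2 ^ (m + 1 + j + 1)⌋₊ = 2 * ⌊t * 2 ^ (m + 1 + j)⌋₊ + 1 := by omega
        rw [e2]
        exact hstep _ _ (by omega) (by omega)
  -- Since `(t - s) * 2 ^ (m + 1) ≤ 2`, at most two grid intervals separate the rounded endpoints.
  have hmid : |x ((⌊t * 2 ^ (m + 1)⌋₊ : ℝ) / 2 ^ (m + 1)) -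
      x ((⌈s * 2 ^ (m + 1)⌉₊ : ℝ) / 2 ^ (m + 1))| ≤ 2 * (q ^ (m + 1) * A) := by
    have c1 := hcf (m + 1) le_rfl
    have h1 : (t - s) * 2 ^ (m + 1) ≤ 2 := by
      have h2 : (1 / 2 : ℝ) ^ m * 2 ^ (m + 1) = 2 := by
        rw [pow_succ, ← mul_assoc, ← mul_pow]; norm_num
      exact (mul_le_mul_of_nonneg_right hm2 (by positivity)).trans_eq h2
    have c2 : ⌊t * 2 ^ (m + 1)⌋₊ ≤ ⌈s * 2 ^ (m + 1)⌉₊ + 2 := by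
      have : (⌊t * 2 ^ (m + 1)⌋₊ : ℝ) ≤ ⌈s * 2 ^ (m + 1)⌉₊ + 2 := by
        linarith [hfloor (m + 1), hceil' (m + 1)]
      exact_mod_cast this
    have hB : 0 ≤ q ^ (m + 1) * A := by positivity
    obtain h | h | h : ⌊t * 2 ^ (m + 1)⌋₊ = ⌈s * 2 ^ (m + 1)⌉₊ ∨
        ⌊t * 2 ^ (m + 1)⌋₊ = ⌈s * 2 ^ (m + 1)⌉₊ + 1 ∨
        ⌊t * 2 ^ (m + 1)⌋₊ = ⌈s * 2 ^ (m + 1)⌉₊ + 1 + 1 := by omega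
    · rw [h, sub_self, abs_zero]; linarith
    · have := hstep (m + 1) ⌈s * 2 ^ (m + 1)⌉₊ le_rfl (by omega)
      rw [h]; linarith
    · have h3 := hstep (m + 1) ⌈s * 2 ^ (m + 1)⌉₊ le_rfl (by omega)
      have h4 := hstep (m + 1) (⌈s * 2 ^ (m + 1)⌉₊ + 1) (by omega) (by omega)
      rw [h]
      rw [abs_le] at *
      constructor <;> linarith
  have hqm : q ^ (m + 1) ≤ (t - s) ^ (γ / 2) := by
    have e : q ^ (m + 1) = ((1 / 2 : ℝ) ^ (m + 1)) ^ (γ / 2) := by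
      rw [hq, ← Real.rpow_natCast, ← Real.rpow_natCast, ← Real.rpow_mul (by norm_num),
        ← Real.rpow_mul (by norm_num), one_div, ← Real.rpow_neg_one, ← Real.rpow_mul (by norm_num)]
      congr 1; ring
    rw [e]
    exact Real.rpow_le_rpow (by positivity) hm1.le (by linarith)
  have htot : |x t - x s| ≤ 2 / (1 - q) * (q ^ (m + 1) * A) := by
    have e : 2 / (1 - q) * (q ^ (m + 1) * A) =
        q ^ (m + 2) * A / (1 - q) + 2 * (q ^ (m + 1) * A) + q ^ (m + 2) * A / (1 - q) := by
      have : 1 - q ≠ 0 := by linarith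
      field_simp
      ring
    rw [e]
    rw [abs_le] at *
    constructor <;> linarith
  refine htot.trans (mul_le_mul_of_nonneg_left (mul_le_mul_of_nonneg_right hqm hA0) ?_)
  exact div_nonneg (by norm_num) (by linarith)

end

/-! ### Existence of the Young integral -/

/-- The left Riemann–Stieltjes sum of `g` against `x` over the dyadic partition of level `n`. -/
def dyadicSum (g x : ℝ → ℝ) (n : ℕ) : ℝ :=
  ∑ k ∈ Finset.range (2 ^ n), g (k / 2 ^ n) * (x (((k : ℝ) + 1) / 2 ^ n) - x (k / 2 ^ n))

/-- The superadditive control of a path of finite dyadic energy. -/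
def youngControl (γ : ℝ) (x : ℝ → ℝ) (s t : ℝ) : ℝ := (t - s) + dyadicEnergy γ x s t

section

variable {γ : ℝ} {x : ℝ → ℝ}

theorem youngControl_nonneg (γ : ℝ) (x : ℝ → ℝ) {s t : ℝ} (h : s ≤ t) :
    0 ≤ youngControl γ x s t := add_nonneg (by linarith) (dyadicEnergy_nonneg _ _ _ _)

theorem youngControl_self (γ : ℝ) (x : ℝ → ℝ) (s : ℝ) : youngControl γ x s s = 0 := by
  simp [youngControl, dyadicEnergy_self]

theorem FiniteDyadicEnergy.youngControl_add_le (hx : FiniteDyadicEnergy γ x) {s u t : ℝ}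
    (hsu : s ≤ u) (hut : u ≤ t) :
    youngControl γ x s u + youngControl γ x u t ≤ youngControl γ x s t := by
  have := hx.add_le hsu hut
  unfold youngControl
  linarith

theorem FiniteDyadicEnergy.exists_youngControl_lt (hx : FiniteDyadicEnergy γ x) {η : ℝ}
    (hη : 0 < η) : ∃ δ > 0, ∀ s t, t - s < δ → youngControl γ x s t < η := by
  obtain ⟨δ, hδ, h⟩ := hx.exists_lt (half_pos hη)
  refine ⟨min δ (η / 2), by positivity, fun s t hst => ?_⟩
  have h1 := h s t (hst.trans_le (min_le_left _ _))
  have h2 := hst.trans_le (min_le_right _ _)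
  unfold youngControl
  linarith

theorem FiniteDyadicEnergy.sum_youngControl_le (hx : FiniteDyadicEnergy γ x) {t : ℕ → ℝ} :
    ∀ N : ℕ, (∀ i < N, t i ≤ t (i + 1)) → t 0 ≤ t N ∧
      ∑ i ∈ Finset.range N, youngControl γ x (t i) (t (i + 1)) ≤ youngControl γ x (t 0) (t N)
  | 0, _ => by simp [youngControl_self]
  | N + 1, h => by
    have ⟨h1, h2⟩ := FiniteDyadicEnergy.sum_youngControl_le hx N fun i hi => h i (by omega)
    have h3 := h N (by omega)
    refine ⟨h1.trans h3, ?_⟩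
    rw [Finset.sum_range_succ]
    linarith [hx.youngControl_add_le h1 h3]

/-- An increment of a `τ`-Hölder function times an increment of a path of finite dyadic energy. -/
theorem FiniteDyadicEnergy.abs_mul_abs_le (hx : FiniteDyadicEnergy γ x) (hγ : 0 < γ)
    (hc : Continuous x) {g : ℝ → ℝ} {L τ : ℝ} (hL : 0 ≤ L) (hτ : 0 < τ)
    (hg : ∀ s t, |g t - g s| ≤ L * |t - s| ^ τ) {s t p q e f : ℝ} (hs : 0 ≤ s) (ht : t ≤ 1)
    (hsp : s ≤ p) (hpq : p ≤ q) (hqt : q ≤ t) (hse : s ≤ e) (het : e ≤ t) (hsf : s ≤ f)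
    (hft : f ≤ t) :
    |g f - g e| * |x q - x p| ≤
      L * (2 / (1 - 2 ^ (-(γ / 2)))) * youngControl γ x s t ^ (τ + γ / 2 + 1 / 2) := by
  have hq1 : (2 : ℝ) ^ (-(γ / 2)) < 1 :=
    Real.rpow_lt_one_of_one_lt_of_neg (by norm_num) (by linarith)
  have hst : s ≤ t := hse.trans het
  have hΩ0 := youngControl_nonneg γ x hst
  set Ω := youngControl γ x s t with hΩ
  have hC : 0 ≤ 2 / (1 - (2 : ℝ) ^ (-(γ / 2))) := div_nonneg (by norm_num) (by linarith)
  rcases hpq.eq_or_lt with rfl | hpq'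
  · rw [sub_self, abs_zero, mul_zero]
    exact mul_nonneg (mul_nonneg hL hC) (Real.rpow_nonneg hΩ0 _)
  have hEst := dyadicEnergy_nonneg γ x s t
  have hE : dyadicEnergy γ x p q ≤ Ω := by
    have h1 := hx.add_le hsp (hpq.trans hqt)
    have h2 := hx.add_le hpq hqt
    have h3 := dyadicEnergy_nonneg γ x s p
    have h4 := dyadicEnergy_nonneg γ x q t
    rw [hΩ, youngControl]
    linarith
  have htsΩ : t - s ≤ Ω := by rw [hΩ, youngControl]; linarith
  have h1 : |g f - g e| ≤ L * Ω ^ τ := by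
    refine (hg e f).trans (mul_le_mul_of_nonneg_left ?_ hL)
    refine Real.rpow_le_rpow (abs_nonneg _) ?_ hτ.le
    rw [abs_le]; constructor <;> linarith
  -- The square root of the energy supplies the extra power `1 / 2` of the control.
  have h2 : |x q - x p| ≤ 2 / (1 - 2 ^ (-(γ / 2))) * (Ω ^ (γ / 2) * Ω ^ (1 / 2 : ℝ)) := by
    refine (hx.abs_sub_le hγ hc (hs.trans hsp) hpq' (hqt.trans ht)).trans
      (mul_le_mul_of_nonneg_left (mul_le_mul ?_ ?_ (Real.sqrt_nonneg _) (by positivity)) hC)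
    · exact Real.rpow_le_rpow (by linarith) (by linarith) (by linarith)
    · rw [← Real.sqrt_eq_rpow]; exact Real.sqrt_le_sqrt hE
  calc |g f - g e| * |x q - x p|
      ≤ L * Ω ^ τ * (2 / (1 - 2 ^ (-(γ / 2))) * (Ω ^ (γ / 2) * Ω ^ (1 / 2 : ℝ))) :=
        mul_le_mul h1 h2 (abs_nonneg _) (by positivity)
    _ = _ := by
      rw [Real.rpow_add_of_nonneg hΩ0 (by linarith) (by norm_num),
        Real.rpow_add_of_nonneg hΩ0 hτ.le (by linarith)]
      ring

/-- Tagged sums along a dyadic partition are close to the sum along the finest dyadic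
partition. -/
theorem FiniteDyadicEnergy.exists_abs_dyadicSum_sub_le (hx : FiniteDyadicEnergy γ x)
    (hγ : 0 < γ) (hc : Continuous x) {g : ℝ → ℝ} {L τ : ℝ} (hL : 0 ≤ L) (hτ : 0 < τ)
    (hg : ∀ s t, |g t - g s| ≤ L * |t - s| ^ τ) (ha : 1 < τ + γ / 2 + 1 / 2) :
    ∃ B : ℝ, 0 ≤ B ∧ ∀ (n N : ℕ) (c e : ℕ → ℕ), c 0 = 0 → c N = 2 ^ n →
      (∀ i < N, c i ≤ e i ∧ e i ≤ c (i + 1)) →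
      |dyadicSum g x n - ∑ i ∈ Finset.range N,
        g (e i / 2 ^ n) * (x (c (i + 1) / 2 ^ n) - x (c i / 2 ^ n))| ≤
      B * ∑ i ∈ Finset.range N,
        youngControl γ x (c i / 2 ^ n) (c (i + 1) / 2 ^ n) ^ (τ + γ / 2 + 1 / 2) := by
  set a := τ + γ / 2 + 1 / 2 with hadef
  have hq1 : (2 : ℝ) ^ (-(γ / 2)) < 1 :=
    Real.rpow_lt_one_of_one_lt_of_neg (by norm_num) (by linarith)
  have h2a : (2 : ℝ) ^ (1 - a) < 1 :=
    Real.rpow_lt_one_of_one_lt_of_neg (by norm_num) (by linarith)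
  set K := L * (2 / (1 - (2 : ℝ) ^ (-(γ / 2)))) with hK
  have hK0 : 0 ≤ K := mul_nonneg hL (div_nonneg (by norm_num) (by linarith))
  have hC0 : 0 ≤ 2 * K / (1 - (2 : ℝ) ^ (1 - a)) := div_nonneg (by linarith) (by linarith)
  refine ⟨2 * K / (1 - (2 : ℝ) ^ (1 - a)) + K, by linarith, fun n N c e hc0 hcN hce => ?_⟩
  have hp : (0 : ℝ) < 2 ^ n := by positivity
  have hdiv : ∀ {i j : ℕ}, i ≤ j → (i : ℝ) / 2 ^ n ≤ (j : ℝ) / 2 ^ n := fun h => by gcongr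
  have hdiv1 : ∀ {i : ℕ}, i ≤ 2 ^ n → (i : ℝ) / 2 ^ n ≤ 1 := fun h => by
    rw [div_le_one hp]; exact_mod_cast h
  -- The defect of `g_p (x_q - x_p)` at an intermediate `r` is, up to sign, `(g_r - g_p) (x_q -
  -- x_r)`.
  have hYL := abs_sum_Ico_sub_le_of_superadditive (M := 2 ^ n) (K := K) (a := a)
    (Ξ := fun p q => g (p / 2 ^ n) * (x (q / 2 ^ n) - x (p / 2 ^ n)))
    (Ω := fun p q => youngControl γ x (p / 2 ^ n) (q / 2 ^ n)) ha hK0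
    (fun p => by simp) (fun p => youngControl_self _ _ _)
    (fun p q h => youngControl_nonneg γ x (hdiv h))
    (fun p r q h1 h2 => hx.youngControl_add_le (hdiv h1) (hdiv h2))
    (fun p r q h1 h2 h3 => by
      have h := hx.abs_mul_abs_le hγ hc hL hτ hg (s := p / 2 ^ n) (t := q / 2 ^ n)
        (p := r / 2 ^ n) (q := q / 2 ^ n) (e := p / 2 ^ n) (f := r / 2 ^ n)
        (by positivity) (hdiv1 h3) (hdiv h1) (hdiv h2) le_rfl le_rfl (hdiv (h1.trans h2))
        (hdiv h1) (hdiv h2)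
      rw [← abs_mul] at h
      rw [← abs_neg]
      refine le_of_eq_of_le ?_ h
      congr 1
      ring)
  have hmono : ∀ M ≤ N, c M ≤ 2 ^ n ∧ ∑ k ∈ Finset.range (c M),
      g (k / 2 ^ n) * (x (((k : ℝ) + 1) / 2 ^ n) - x (k / 2 ^ n)) =
      ∑ i ∈ Finset.range M, ∑ k ∈ Finset.Ico (c i) (c (i + 1)),
        g (k / 2 ^ n) * (x (((k : ℝ) + 1) / 2 ^ n) - x (k / 2 ^ n)) := by
    intro M
    have hup : ∀ j, M + j = N → c M ≤ c N := by
      intro j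
      induction j generalizing M with
      | zero => rintro rfl; exact le_rfl
      | succ j ih =>
        intro h
        exact ((hce M (by omega)).1.trans (hce M (by omega)).2).trans (ih (M + 1) (by omega))
    intro hM
    refine ⟨(hup (N - M) (by omega)).trans_eq hcN, ?_⟩
    clear hup
    induction M with
    | zero => simp [hc0]
    | succ M ih =>
      rw [Finset.sum_range_succ, ← ih (by omega), Finset.sum_range_add_sum_Ico _
        ((hce M (by omega)).1.trans (hce M (by omega)).2)]
  have hS : dyadicSum g x n = ∑ i ∈ Finset.range N, ∑ k ∈ Finset.Ico (c i) (c (i + 1)),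
        g (k / 2 ^ n) * (x (((k : ℝ) + 1) / 2 ^ n) - x (k / 2 ^ n)) := by
    rw [← (hmono N le_rfl).2, hcN]; rfl
  rw [hS, ← Finset.sum_sub_distrib, Finset.mul_sum]
  refine (Finset.abs_sum_le_sum_abs _ _).trans (Finset.sum_le_sum fun i hi => ?_)
  have hiN := Finset.mem_range.1 hi
  obtain ⟨h1, h2⟩ := hce i hiN
  have h3 := (hmono (i + 1) (by omega)).1
  have b1 := hYL (c (i + 1) - c i) (c i) (c (i + 1)) (by omega) h3
  have b2 := hx.abs_mul_abs_le hγ hc hL hτ hg (s := c i / 2 ^ n) (t := c (i + 1) / 2 ^ n)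
        (p := c i / 2 ^ n) (q := c (i + 1) / 2 ^ n) (e := c i / 2 ^ n) (f := e i / 2 ^ n)
        (by positivity) (hdiv1 h3) le_rfl (hdiv (h1.trans h2)) le_rfl le_rfl
        (hdiv (h1.trans h2)) (hdiv h1) (hdiv h2)
  rw [← abs_mul] at b2
  rw [add_mul]
  simp only [Nat.cast_add_one] at b1
  calc |∑ k ∈ Finset.Ico (c i) (c (i + 1)),
          g (k / 2 ^ n) * (x (((k : ℝ) + 1) / 2 ^ n) - x (k / 2 ^ n)) -
          g (e i / 2 ^ n) * (x (c (i + 1) / 2 ^ n) - x (c i / 2 ^ n))|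
      = |(∑ k ∈ Finset.Ico (c i) (c (i + 1)),
          g (k / 2 ^ n) * (x (((k : ℝ) + 1) / 2 ^ n) - x (k / 2 ^ n)) -
          g (c i / 2 ^ n) * (x (c (i + 1) / 2 ^ n) - x (c i / 2 ^ n))) -
          (g (e i / 2 ^ n) - g (c i / 2 ^ n)) * (x (c (i + 1) / 2 ^ n) - x (c i / 2 ^ n))| := by
        congr 1; ring
    _ ≤ _ := (abs_sub _ _).trans (add_le_add b1 b2)

/-- Every tagged Riemann–Stieltjes sum of small mesh is close to the dyadic sums of high
level. -/
theorem FiniteDyadicEnergy.exists_mesh (hx : FiniteDyadicEnergy γ x)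
    (hγ : 0 < γ) (hc : Continuous x) {g : ℝ → ℝ} (hgc : Continuous g) {L τ : ℝ} (hL : 0 ≤ L)
    (hτ : 0 < τ) (hg : ∀ s t, |g t - g s| ≤ L * |t - s| ^ τ) (ha : 1 < τ + γ / 2 + 1 / 2)
    {ε : ℝ} (hε : 0 < ε) :
    ∃ δ > 0, ∀ (N : ℕ) (t ξ : ℕ → ℝ), t 0 = 0 → t N = 1 → (∀ i, 0 ≤ t i) →
      (∀ i < N, t i ≤ ξ i ∧ ξ i ≤ t (i + 1)) → (∀ i < N, t (i + 1) - t i < δ) →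
      ∀ᶠ n in atTop, |dyadicSum g x n -
        ∑ i ∈ Finset.range N, g (ξ i) * (x (t (i + 1)) - x (t i))| < ε := by
  obtain ⟨B, hB, h⟩ := hx.exists_abs_dyadicSum_sub_le hγ hc hL hτ hg ha
  set a := τ + γ / 2 + 1 / 2 with hadef
  set T := youngControl γ x 0 1 with hT
  have hT0 : 0 ≤ T := youngControl_nonneg γ x zero_le_one
  -- Because `a > 1`, a uniform bound `η` on the control of each cell makes the total error `B η ^
  -- (a - 1) T` small, however many cells there are.
  obtain ⟨η, hη, hη2⟩ : ∃ η > 0, B * (η ^ (a - 1) * T) < ε / 2 := by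
    have hlim : Tendsto (fun η : ℝ => B * (η ^ (a - 1) * T)) (𝓝[>] 0) (𝓝 (B * (0 ^ (a - 1) * T))) :=
      (((Real.continuousAt_rpow_const 0 (a - 1) (Or.inr (by linarith))).tendsto.mul_const T).const_mul
        B).mono_left nhdsWithin_le_nhds
    rw [Real.zero_rpow (by linarith), zero_mul, mul_zero] at hlim
    obtain ⟨η, h1, h2⟩ := ((hlim.eventually (gt_mem_nhds (half_pos hε))).and
      self_mem_nhdsWithin).exists
    exact ⟨η, h2, h1⟩
  obtain ⟨δ, hδ, hδη⟩ := hx.exists_youngControl_lt hη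
  refine ⟨δ, hδ, fun N t ξ ht0 htN htnn htξ hmesh => ?_⟩
  have hξnn : ∀ i < N, 0 ≤ ξ i := fun i hi => (htnn i).trans (htξ i hi).1
  have hlimt : ∀ i, Tendsto (fun n : ℕ => (⌊t i * 2 ^ n⌋₊ : ℝ) / 2 ^ n) atTop (𝓝 (t i)) :=
    fun i => tendsto_floor_dyadic (htnn i)
  -- An arbitrary partition is handled by rounding its points and tags down to the grid of level
  -- `n`: continuity makes the rounded sums converge to the given one. The level needed depends on
  -- the partition, but `δ` does not.
  have hconv : Tendsto (fun n : ℕ => ∑ i ∈ Finset.range N, g ((⌊ξ i * 2 ^ n⌋₊ : ℝ) / 2 ^ n) *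
      (x ((⌊t (i + 1) * 2 ^ n⌋₊ : ℝ) / 2 ^ n) - x ((⌊t i * 2 ^ n⌋₊ : ℝ) / 2 ^ n))) atTop
      (𝓝 (∑ i ∈ Finset.range N, g (ξ i) * (x (t (i + 1)) - x (t i)))) :=
    tendsto_finsetSum _ fun i hi =>
      ((hgc.tendsto _).comp (tendsto_floor_dyadic (hξnn i (Finset.mem_range.1 hi)))).mul
        (((hc.tendsto _).comp (hlimt (i + 1))).sub ((hc.tendsto _).comp (hlimt i)))
  have hmesh' : ∀ᶠ n : ℕ in atTop, ∀ i ∈ Finset.range N,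
      (⌊t (i + 1) * 2 ^ n⌋₊ : ℝ) / 2 ^ n - (⌊t i * 2 ^ n⌋₊ : ℝ) / 2 ^ n < δ :=
    (Filter.eventually_all_finset _).2 fun i hi =>
      ((hlimt (i + 1)).sub (hlimt i)).eventually (gt_mem_nhds (hmesh i (Finset.mem_range.1 hi)))
  filter_upwards [hmesh', (Metric.tendsto_nhds.1 hconv) (ε / 2) (half_pos hε)] with n hn1 hn2
  have hfl : ∀ i < N, ⌊t i * 2 ^ n⌋₊ ≤ ⌊ξ i * 2 ^ n⌋₊ ∧
      ⌊ξ i * 2 ^ n⌋₊ ≤ ⌊t (i + 1) * 2 ^ n⌋₊ := fun i hi =>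
    ⟨Nat.floor_mono (mul_le_mul_of_nonneg_right (htξ i hi).1 (by positivity)),
      Nat.floor_mono (mul_le_mul_of_nonneg_right (htξ i hi).2 (by positivity))⟩
  have hfl' : ∀ i < N, (⌊t i * 2 ^ n⌋₊ : ℝ) / 2 ^ n ≤ (⌊t (i + 1) * 2 ^ n⌋₊ : ℝ) / 2 ^ n :=
    fun i hi => div_le_div_of_nonneg_right
      (by exact_mod_cast (hfl i hi).1.trans (hfl i hi).2) (by positivity)
  have hN1 : ⌊t N * 2 ^ n⌋₊ = 2 ^ n := by
    rw [htN, one_mul]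
    exact_mod_cast Nat.floor_natCast (R := ℝ) (2 ^ n)
  have e0 : ((⌊t 0 * 2 ^ n⌋₊ : ℕ) : ℝ) / 2 ^ n = 0 := by simp [ht0]
  have e1 : ((⌊t N * 2 ^ n⌋₊ : ℕ) : ℝ) / 2 ^ n = 1 := by rw [hN1]; simp
  have hb := h n N (fun i => ⌊t i * 2 ^ n⌋₊) (fun i => ⌊ξ i * 2 ^ n⌋₊) (by simp [ht0]) hN1 hfl
  -- One factor of the control is summed by superadditivity; the remaining power `a - 1` is at most
  -- `η ^ (a - 1)`.
  have hsum : ∑ i ∈ Finset.range N, youngControl γ x ((⌊t i * 2 ^ n⌋₊ : ℝ) / 2 ^ n)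
      ((⌊t (i + 1) * 2 ^ n⌋₊ : ℝ) / 2 ^ n) ^ a ≤ η ^ (a - 1) * T := by
    have hs := (hx.sum_youngControl_le (t := fun i => (⌊t i * 2 ^ n⌋₊ : ℝ) / 2 ^ n) N hfl').2
    simp only [e0, e1] at hs
    refine le_trans ?_ (mul_le_mul_of_nonneg_left hs (by positivity))
    rw [Finset.mul_sum]
    refine Finset.sum_le_sum fun i hi => ?_
    have hnn := youngControl_nonneg γ x (hfl' i (Finset.mem_range.1 hi))
    calc _ = youngControl γ x ((⌊t i * 2 ^ n⌋₊ : ℝ) / 2 ^ n)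
            ((⌊t (i + 1) * 2 ^ n⌋₊ : ℝ) / 2 ^ n) ^ ((a - 1) + 1) := by congr 1; ring
      _ = _ := by rw [Real.rpow_add_of_nonneg hnn (by linarith) zero_le_one, Real.rpow_one]
      _ ≤ _ := mul_le_mul_of_nonneg_right
          (Real.rpow_le_rpow hnn (hδη _ _ (hn1 i hi)).le (by linarith)) hnn
  have hb2 := hb.trans (mul_le_mul_of_nonneg_left hsum hB)
  rw [Real.dist_eq] at hn2
  have := (_root_.abs_sub_le (dyadicSum g x n) _ _).trans_lt (add_lt_add (hb2.trans_lt hη2) hn2)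
  linarith

/-- The dyadic sums converge. -/
theorem FiniteDyadicEnergy.exists_tendsto_dyadicSum (hx : FiniteDyadicEnergy γ x)
    (hγ : 0 < γ) (hc : Continuous x) {g : ℝ → ℝ} (hgc : Continuous g) {L τ : ℝ} (hL : 0 ≤ L)
    (hτ : 0 < τ) (hg : ∀ s t, |g t - g s| ≤ L * |t - s| ^ τ) (ha : 1 < τ + γ / 2 + 1 / 2) :
    ∃ J, Tendsto (dyadicSum g x) atTop (𝓝 J) := by
  refine cauchySeq_tendsto_of_complete (Metric.cauchySeq_iff'.2 fun ε hε => ?_)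
  obtain ⟨δ, hδ, h⟩ := hx.exists_mesh hγ hc hgc hL hτ hg ha (half_pos hε)
  obtain ⟨N, hN⟩ := exists_pow_lt_of_lt_one hδ (by norm_num : (1 / 2 : ℝ) < 1)
  -- The dyadic partition of level `m` is itself a partition of small mesh. Levels `m` and `N` are
  -- then compared through a common, much finer level.
  have key : ∀ m ≥ N, ∀ᶠ n in atTop, |dyadicSum g x n - dyadicSum g x m| < ε / 2 := by
    intro m hm
    have := h (2 ^ m) (fun i => i / 2 ^ m) (fun i => i / 2 ^ m) (by simp) (by simp)
      (fun i => by positivity) (fun i _ => ⟨le_rfl, by gcongr; simp⟩) (fun i _ => by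
        refine lt_of_le_of_lt ?_ hN
        refine le_trans ?_ (pow_le_pow_of_le_one (by norm_num) (by norm_num) hm)
        rw [one_div, inv_pow]
        push_cast
        apply le_of_eq; ring)
    simpa only [dyadicSum, Nat.cast_add_one] using this
  refine ⟨N, fun m hm => ?_⟩
  obtain ⟨n, h1, h2⟩ := ((key m hm).and (key N le_rfl)).exists
  rw [Real.dist_eq]
  rw [abs_lt] at *
  constructor <;> linarith

end

theorem abs_iccExtend_sub_le {g : I → ℝ} {L τ : ℝ} (hL : 0 ≤ L) (hτ : 0 < τ)
    (hg : ∀ s t : I, |g t - g s| ≤ L * |(t : ℝ) - s| ^ τ) (s t : ℝ) :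
    |Set.IccExtend zero_le_one g t - Set.IccExtend zero_le_one g s| ≤ L * |t - s| ^ τ :=
  (hg _ _).trans (mul_le_mul_of_nonneg_left (Real.rpow_le_rpow (abs_nonneg _)
    (Set.abs_projIcc_sub_projIcc zero_le_one) hτ.le) hL)

theorem continuous_of_abs_sub_le_rpow {g : I → ℝ} {L τ : ℝ} (hτ : 0 < τ)
    (hg : ∀ s t : I, |g t - g s| ≤ L * |(t : ℝ) - s| ^ τ) : Continuous g := by
  refine continuous_iff_continuousAt.2 fun s => tendsto_iff_dist_tendsto_zero.2 ?_
  have h : Tendsto (fun t : I => L * |(t : ℝ) - s| ^ τ) (𝓝 s) (𝓝 (L * |(s : ℝ) - s| ^ τ)) := by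
    have : Continuous fun t : I => L * |(t : ℝ) - s| ^ τ :=
      continuous_const.mul ((continuous_subtype_val.sub continuous_const).abs.rpow_const
        fun _ => Or.inr hτ.le)
    exact this.tendsto s
  rw [sub_self, abs_zero, Real.zero_rpow hτ.ne', mul_zero] at h
  exact squeeze_zero (fun _ => dist_nonneg) (fun t => hg s t) h

/-- A continuous path on the unit interval of finite dyadic energy is integrable, in the sense of
Young, against every Hölder function of large enough exponent; the integral is the limit of the
dyadic sums. -/
theorem exists_hasYoungIntegral {γ : ℝ} (hγ : 0 < γ) {x g : I → ℝ} (hc : Continuous x)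
    (hx : FiniteDyadicEnergy γ (Set.IccExtend zero_le_one x)) {L τ : ℝ} (hL : 0 ≤ L) (hτ : 0 < τ)
    (hg : ∀ s t : I, |g t - g s| ≤ L * |(t : ℝ) - s| ^ τ) (ha : 1 < τ + γ / 2 + 1 / 2) :
    ∃ J, HasYoungIntegral g x J := by
  have hgc := continuous_of_abs_sub_le_rpow hτ hg
  have hg' := abs_iccExtend_sub_le hL hτ hg
  have hc' : Continuous (Set.IccExtend zero_le_one x) := hc.Icc_extend'
  have hgc' : Continuous (Set.IccExtend zero_le_one g) := hgc.Icc_extend'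
  obtain ⟨J, hJ⟩ := hx.exists_tendsto_dyadicSum hγ hc' hgc' hL hτ hg' ha
  refine ⟨J, fun ε hε => ?_⟩
  obtain ⟨δ, hδ, h⟩ := hx.exists_mesh hγ hc' hgc' hL hτ hg' ha (half_pos hε)
  refine ⟨δ, hδ, fun N t ξ _ ht0 htN htξ hmesh => ?_⟩
  -- Partition points are repeated beyond `N`, so that every `t' i` stays non-negative; the default
  -- tag `0` is never read by the sums.
  let t' : ℕ → ℝ := fun i => t ⟨min i N, by omega⟩
  let ξ' : ℕ → ℝ := fun i => if h : i < N then ξ ⟨i, h⟩ else 0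
  have hl : ∀ i : Fin N, t' i = t i.castSucc := fun i => by
    have : (⟨min (i : ℕ) N, by omega⟩ : Fin (N + 1)) = i.castSucc := Fin.ext (by simp)
    simp only [t', this]
  have hr : ∀ i : Fin N, t' (i + 1) = t i.succ := fun i => by
    have : (⟨min ((i : ℕ) + 1) N, by omega⟩ : Fin (N + 1)) = i.succ := Fin.ext (by simp)
    simp only [t', this]
  have hξ : ∀ i : Fin N, ξ' i = ξ i := fun i => by simp [ξ']
  have ev := h N t' ξ' (by simpa [t'] using congrArg Subtype.val ht0)
    (by
      have : t' N = t (Fin.last N) := by simp [t', Fin.last]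
      rw [this, htN]; rfl) (fun i => (t _).2.1)
    (fun i hi => by
      have := htξ ⟨i, hi⟩
      rw [show t' i = _ from hl ⟨i, hi⟩, show t' (i + 1) = _ from hr ⟨i, hi⟩,
        show ξ' i = _ from hξ ⟨i, hi⟩]
      exact this)
    (fun i hi => by
      have := hmesh ⟨i, hi⟩
      rw [show t' i = _ from hl ⟨i, hi⟩, show t' (i + 1) = _ from hr ⟨i, hi⟩]
      exact this)
  have hsum : ∑ i ∈ Finset.range N, Set.IccExtend zero_le_one g (ξ' i) *
      (Set.IccExtend zero_le_one x (t' (i + 1)) - Set.IccExtend zero_le_one x (t' i)) =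
      ∑ i : Fin N, g (ξ i) * (x (t i.succ) - x (t i.castSucc)) := by
    rw [Finset.sum_range]
    refine Finset.sum_congr rfl fun i _ => ?_
    rw [hl, hr, hξ, Set.IccExtend_val, Set.IccExtend_val, Set.IccExtend_val]
  rw [hsum] at ev
  have hle := le_of_tendsto ((hJ.sub_const _).abs) (ev.mono fun n hn => hn.le)
  rw [abs_sub_comm]
  linarith

/-- The Young integral is the limit of the dyadic sums. -/
theorem HasYoungIntegral.tendsto_dyadicSum {g x : I → ℝ} {J : ℝ} (h : HasYoungIntegral g x J) :
    Tendsto (dyadicSum (Set.IccExtend zero_le_one g) (Set.IccExtend zero_le_one x)) atTop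
      (𝓝 J) := by
  refine Metric.tendsto_atTop.2 fun ε hε => ?_
  obtain ⟨δ, hδ, hJ⟩ := h ε hε
  obtain ⟨N, hN⟩ := exists_pow_lt_of_lt_one hδ (by norm_num : (1 / 2 : ℝ) < 1)
  refine ⟨N, fun n hn => ?_⟩
  have hle : ∀ {i j : ℕ}, i ≤ j → (i : ℝ) / 2 ^ n ≤ (j : ℝ) / 2 ^ n := fun h => by gcongr
  have hmem : ∀ i : ℕ, i ≤ 2 ^ n → (i : ℝ) / 2 ^ n ∈ I := fun i hi =>
    ⟨by positivity, by rw [div_le_one (by positivity)]; exact_mod_cast hi⟩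
  have hS := hJ (2 ^ n) (fun i => ⟨(i : ℕ) / 2 ^ n, hmem i (by omega)⟩)
    (fun i => ⟨(i : ℕ) / 2 ^ n, hmem i (by omega)⟩)
    (fun i j hij => Subtype.mk_le_mk.2 (hle hij)) (Subtype.ext (by simp))
    (Subtype.ext (by simp))
    (fun i => ⟨Subtype.mk_le_mk.2 (hle (by simp)), Subtype.mk_le_mk.2 (hle (by simp))⟩)
    (fun i => by
      refine lt_of_le_of_lt ?_ hN
      refine le_trans ?_ (pow_le_pow_of_le_one (by norm_num) (by norm_num) hn)
      rw [one_div, inv_pow]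
      simp only [Fin.val_succ, Fin.val_castSucc]
      push_cast
      apply le_of_eq; ring)
  rw [Real.dist_eq]
  convert hS using 3
  rw [dyadicSum, Finset.sum_range]
  refine Finset.sum_congr rfl fun i _ => ?_
  rw [Set.IccExtend_of_mem _ _ (hmem i (by omega)), Set.IccExtend_of_mem _ _ (hmem i (by omega)),
    ← Nat.cast_add_one, Set.IccExtend_of_mem _ _ (hmem (i + 1) (by omega))]
  rfl

/-! ### Hermite polynomials of Gaussian variables -/

/-- The probabilists' Hermite polynomial with real coefficients. -/
def hermiteReal (n : ℕ) : Polynomial ℝ := (Polynomial.hermite n).map (Int.castRingHom ℝ)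

theorem aeval_hermite_eq (n : ℕ) (x : ℝ) :
    Polynomial.aeval x (Polynomial.hermite n) = (hermiteReal n).eval x := by
  rw [Polynomial.aeval_def, Polynomial.eval₂_eq_eval_map, hermiteReal, algebraMap_int_eq]

theorem hermiteReal_zero : hermiteReal 0 = 1 := by simp [hermiteReal]

theorem hermiteReal_succ (n : ℕ) :
    hermiteReal (n + 1) = Polynomial.X * hermiteReal n - Polynomial.derivative (hermiteReal n) := by
  simp [hermiteReal, Polynomial.hermite_succ]

theorem derivative_hermiteReal (n : ℕ) :
    Polynomial.derivative (hermiteReal (n + 1)) = ((n : Polynomial ℝ) + 1) * hermiteReal n := by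
  induction n with
  | zero => simp [hermiteReal_succ, hermiteReal_zero]
  | succ n ih =>
    rw [hermiteReal_succ (n + 1), Polynomial.derivative_sub, Polynomial.derivative_mul, ih]
    simp only [Polynomial.derivative_X, Polynomial.derivative_mul, Polynomial.derivative_add,
      Polynomial.derivative_natCast, Polynomial.derivative_one]
    rw [hermiteReal_succ n]
    push_cast
    ring

theorem integrable_eval_gaussianReal (v : ℝ≥0) (p : Polynomial ℝ) :
    Integrable (fun x => p.eval x) (gaussianReal 0 v) := by
  have hpow : ∀ k : ℕ, Integrable (fun x : ℝ => x ^ k) (gaussianReal 0 v) := by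
    intro k
    rcases eq_or_ne k 0 with rfl | hk
    · simp
    · have h := (memLp_id_gaussianReal (μ := 0) (v := v) (k : ℝ≥0)).integrable_norm_pow
        (p := k) hk
      refine h.mono' (by fun_prop) (Eventually.of_forall fun x => ?_)
      simp
  simp only [Polynomial.eval_eq_sum_range]
  exact integrable_finsetSum _ fun k _ => (hpow k).const_mul _

/-- Gaussian integration by parts for polynomials. -/
theorem integral_mul_eval_gaussianReal (v : ℝ≥0) (p : Polynomial ℝ) :
    ∫ x, x * p.eval x ∂gaussianReal 0 v =
      v * ∫ x, (Polynomial.derivative p).eval x ∂gaussianReal 0 v := by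
  -- Variance zero gives a Dirac mass, without density; it occurs in the application when `h = ± k`.
  rcases eq_or_ne v 0 with rfl | hv
  · simp
  have hint : ∀ q : Polynomial ℝ, Integrable fun x => gaussianPDFReal 0 v x * q.eval x := by
    intro q
    have h := integrable_eval_gaussianReal v q
    rw [gaussianReal_of_var_ne_zero 0 hv, integrable_withDensity_iff_integrable_smul'
      (measurable_gaussianPDF 0 v) (Eventually.of_forall fun _ => gaussianPDF_lt_top)] at h
    simpa [toReal_gaussianPDF] using h
  have hv' : (v : ℝ) ≠ 0 := by exact_mod_cast hv
  have hderiv : ∀ x, HasDerivAt (fun x => gaussianPDFReal 0 v x * p.eval x)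
      (gaussianPDFReal 0 v x * (Polynomial.derivative p - Polynomial.C (v : ℝ)⁻¹ *
        (Polynomial.X * p)).eval x) x := by
    intro x
    have h1 : HasDerivAt (gaussianPDFReal 0 v) (gaussianPDFReal 0 v x * (-(x / v))) x := by
      unfold gaussianPDFReal
      have h2 : HasDerivAt (fun y : ℝ => -(y - 0) ^ 2 / (2 * v)) (-(x / v)) x := by
        have h3 : HasDerivAt (fun y : ℝ => -(y - 0) ^ 2 / (2 * v))
            (-(2 * (x - 0) * 1) / (2 * (v : ℝ))) x := by
          have := ((((hasDerivAt_id x).sub_const 0).pow 2).neg).div_const (2 * (v : ℝ))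
          simpa using this
        refine h3.congr_deriv ?_
        field_simp
        ring
      refine (h2.exp.const_mul (√(2 * Real.pi * v))⁻¹).congr_deriv ?_
      ring
    refine (h1.mul (p.hasDerivAt x)).congr_deriv ?_
    simp only [Polynomial.eval_sub, Polynomial.eval_mul, Polynomial.eval_C, Polynomial.eval_X]
    ring
  -- The derivative of density times polynomial integrates to zero, and the density satisfies `φ' =
  -- -(x / v) φ`.
  have h0 := integral_eq_zero_of_hasDerivAt_of_integrable hderiv (hint _) (hint _)
  rw [integral_gaussianReal_eq_integral_smul hv, integral_gaussianReal_eq_integral_smul hv]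
  simp only [smul_eq_mul]
  have e : ∀ x, gaussianPDFReal 0 v x * (Polynomial.derivative p - Polynomial.C (v : ℝ)⁻¹ *
        (Polynomial.X * p)).eval x = gaussianPDFReal 0 v x * (Polynomial.derivative p).eval x -
        (v : ℝ)⁻¹ * (gaussianPDFReal 0 v x * (Polynomial.X * p).eval x) := by
    intro x; simp; ring
  simp only [e] at h0
  rw [integral_sub (hint _) ((hint _).const_mul _), integral_const_mul] at h0
  simp only [Polynomial.eval_mul, Polynomial.eval_X] at h0
  have e2 : ∀ x, gaussianPDFReal 0 v x * (x * p.eval x) =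
      gaussianPDFReal 0 v x * x * p.eval x := fun x => by ring
  simp only [e2] at h0 ⊢
  field_simp at h0
  linarith

/-- Mehler's formula for Hermite polynomials. -/
theorem integral_hermiteReal_gaussianReal {c : ℝ} {v : ℝ≥0} (hv : (v : ℝ) = 1 - c ^ 2) (x : ℝ)
    (n : ℕ) : ∫ z, (hermiteReal n).eval (c * x + z) ∂gaussianReal 0 v =
      c ^ n * (hermiteReal n).eval x := by
  induction n using Nat.strong_induction_on with
  | _ n ih =>
    rcases n with _ | n
    · simp [hermiteReal_zero]
    have hI : ∀ q : Polynomial ℝ, Integrable (fun z => q.eval (c * x + z)) (gaussianReal 0 v) := by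
      intro q
      have := integrable_eval_gaussianReal v (q.comp (Polynomial.C (c * x) + Polynomial.X))
      simpa using this
    have hIz : Integrable (fun z => z * (hermiteReal n).eval (c * x + z)) (gaussianReal 0 v) := by
      have := integrable_eval_gaussianReal v
        (Polynomial.X * (hermiteReal n).comp (Polynomial.C (c * x) + Polynomial.X))
      simpa using this
    have hst := integral_mul_eval_gaussianReal v
      ((hermiteReal n).comp (Polynomial.C (c * x) + Polynomial.X))
    simp only [Polynomial.eval_comp, Polynomial.derivative_comp, Polynomial.eval_add,
      Polynomial.eval_C, Polynomial.eval_X, Polynomial.derivative_add, Polynomial.derivative_C,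
      Polynomial.derivative_X, zero_add, one_mul] at hst
    have e : ∀ z, (hermiteReal (n + 1)).eval (c * x + z) =
        c * x * (hermiteReal n).eval (c * x + z) + z * (hermiteReal n).eval (c * x + z) -
          (Polynomial.derivative (hermiteReal n)).eval (c * x + z) := by
      intro z
      rw [hermiteReal_succ]
      simp only [Polynomial.eval_sub, Polynomial.eval_mul, Polynomial.eval_X]
      ring
    simp only [e]
    have i1 : Integrable (fun z => c * x * (hermiteReal n).eval (c * x + z) +
        z * (hermiteReal n).eval (c * x + z)) (gaussianReal 0 v) := ((hI _).const_mul _).add hIz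
    rw [integral_sub i1 (hI _),
      integral_add ((hI _).const_mul _) hIz, integral_const_mul, hst, ih n (by omega), hv]
    -- Integration by parts has left the factor `v - 1 = -c ^ 2` on the derivative term. As `Hₙ'` is
    -- a multiple of `Hₙ₋₁`, the induction hypothesis two steps down evaluates it.
    have hd : (∫ z, (Polynomial.derivative (hermiteReal n)).eval (c * x + z) ∂gaussianReal 0 v) *
        c ^ 2 = c ^ (n + 1) * (Polynomial.derivative (hermiteReal n)).eval x := by
      rcases n with _ | n
      · simp [hermiteReal_zero]
      · rw [derivative_hermiteReal]
        simp only [Polynomial.eval_mul, Polynomial.eval_add, Polynomial.eval_natCast,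
          Polynomial.eval_one]
        rw [integral_const_mul, ih n (by omega)]
        ring
    rw [hermiteReal_succ]
    simp only [Polynomial.eval_sub, Polynomial.eval_mul, Polynomial.eval_X]
    linear_combination -hd

/-! ### Isonormal processes and the isometry of the multiple integral -/

section Wiener

variable {H : Type*} [NormedAddCommGroup H] [InnerProductSpace ℝ H]
  {Ω : Type*} [MeasurableSpace Ω] {W : H → Ω → ℝ} {P : Measure Ω}

theorem IsIsonormalGaussian.memLp (hW : IsIsonormalGaussian W P) (h : H) : MemLp (W h) 2 P :=
  (hW.isGaussianProcess.hasGaussianLaw_eval h).memLp_two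

theorem IsIsonormalGaussian.map_eq (hW : IsIsonormalGaussian W P) (h : H) {v : ℝ≥0}
    (hv : (v : ℝ) = ‖h‖ ^ 2) : P.map (W h) = gaussianReal 0 v := by
  have hG := hW.isGaussianProcess.hasGaussianLaw_eval h
  have hV : Var[W h; P] = v := by
    rw [variance_eq_integral hG.aemeasurable, hW.centered, hv]
    simp only [sub_zero, sq, hW.covariance, real_inner_self_eq_norm_mul_norm]
  rw [hG.map_eq_gaussianReal, hW.centered, hV, Real.toNNReal_coe]

/-- Linearity of `W` is a consequence of the covariance: the difference `D` of the two sides is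
orthogonal to every `W u`, hence to itself. -/
theorem IsIsonormalGaussian.ae_eq (hW : IsIsonormalGaussian W P) (c : ℝ) (h k : H) :
    W k =ᵐ[P] fun ω => c * W h ω + W (k - c • h) ω := by
  have hm := fun u => hW.memLp u
  have hi : ∀ u w, Integrable (fun ω => W u ω * W w ω) P := fun u w => (hm u).integrable_mul (hm w)
  set D : Ω → ℝ := fun ω => W k ω - c * W h ω - W (k - c • h) ω with hD
  have hDu : ∀ u, Integrable (fun ω => D ω * W u ω) P ∧ ∫ ω, D ω * W u ω ∂P = 0 := by
    intro u
    have e : ∀ ω, D ω * W u ω = W k ω * W u ω - c * (W h ω * W u ω) -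
        W (k - c • h) ω * W u ω := fun ω => by simp only [hD]; ring
    simp only [e]
    have i1 : Integrable (fun ω => W k ω * W u ω - c * (W h ω * W u ω)) P :=
      (hi k u).sub ((hi h u).const_mul c)
    refine ⟨i1.sub (hi _ u), ?_⟩
    rw [integral_sub i1 (hi _ u), integral_sub (hi _ _) ((hi _ _).const_mul c),
      integral_const_mul, hW.covariance, hW.covariance, hW.covariance, inner_sub_left,
      real_inner_smul_left]
    ring
  have e : ∀ ω, D ω ^ 2 = D ω * W k ω - c * (D ω * W h ω) - D ω * W (k - c • h) ω :=
    fun ω => by simp only [hD]; ring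
  have i1 : Integrable (fun ω => D ω * W k ω - c * (D ω * W h ω)) P :=
    (hDu k).1.sub ((hDu h).1.const_mul c)
  have hint : Integrable (fun ω => D ω ^ 2) P := by
    simp only [e]; exact i1.sub (hDu _).1
  have h0 : ∫ ω, D ω ^ 2 ∂P = 0 := by
    simp only [e]
    rw [integral_sub i1 (hDu _).1, integral_sub (hDu k).1 ((hDu h).1.const_mul c),
      integral_const_mul, (hDu _).2, (hDu _).2, (hDu _).2]
    ring
  have h1 := (integral_eq_zero_iff_of_nonneg (fun ω => sq_nonneg (D ω)) hint).1 h0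
  filter_upwards [h1] with ω hω
  have : D ω = 0 := by simpa using hω
  simp only [hD] at this
  linarith

theorem IsIsonormalGaussian.memLp_eval (hW : IsIsonormalGaussian W P) (p : Polynomial ℝ) (h : H) :
    MemLp (fun ω => p.eval (W h ω)) 2 P := by
  have hG := hW.isGaussianProcess.hasGaussianLaw_eval h
  have hmap := hW.map_eq h (v := ⟨‖h‖ ^ 2, by positivity⟩) rfl
  have h1 := integrable_eval_gaussianReal ⟨‖h‖ ^ 2, by positivity⟩ (p * p)
  rw [← hmap, integrable_map_measure (by fun_prop) hG.aemeasurable] at h1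
  refine (memLp_two_iff_integrable_sq ?_).2 ?_
  · exact ((p.continuous.measurable).comp_aemeasurable hG.aemeasurable).aestronglyMeasurable
  · refine h1.congr (Eventually.of_forall fun ω => ?_)
    simp [sq]

/-- Splitting `k` along `h` makes `W k` equal to `c * W h` plus an independent Gaussian of variance
`1 - c ^ 2`; integrating that variable first turns `Hₙ(W k)` into `c ^ n * Hₙ(W h)`. The value of
the constant plays no role later. -/
theorem IsIsonormalGaussian.integral_hermite_mul [IsProbabilityMeasure P]
    (hW : IsIsonormalGaussian W P) (n : ℕ) {h k : H} (hh : ‖h‖ = 1) (hk : ‖k‖ = 1) :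
    ∫ ω, (hermiteReal n).eval (W h ω) * (hermiteReal n).eval (W k ω) ∂P =
      (∫ x, (hermiteReal n).eval x ^ 2 ∂gaussianReal 0 1) * inner ℝ h k ^ n := by
  set c : ℝ := inner ℝ h k with hc
  set z := k - c • h with hz
  have hhz : inner ℝ h z = 0 := by
    rw [hz, inner_sub_right, real_inner_smul_right, real_inner_self_eq_norm_sq, hh]
    simp [hc]
  have hz2 : ‖z‖ ^ 2 = 1 - c ^ 2 := by
    have h1 : inner ℝ z z = inner ℝ k z := by
      conv_lhs => rw [hz, inner_sub_left, real_inner_smul_left, ← hz, hhz]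
      ring
    rw [← real_inner_self_eq_norm_sq, h1, hz, inner_sub_right, real_inner_smul_right,
      real_inner_self_eq_norm_sq, hk, real_inner_comm, ← hc]
    ring
  obtain ⟨v, hv⟩ : ∃ v : ℝ≥0, (v : ℝ) = ‖z‖ ^ 2 := ⟨⟨‖z‖ ^ 2, by positivity⟩, rfl⟩
  have hGh := hW.isGaussianProcess.hasGaussianLaw_eval h
  have hGz := hW.isGaussianProcess.hasGaussianLaw_eval z
  have hmh : P.map (W h) = gaussianReal 0 1 := hW.map_eq h (by simp [hh])
  have hmz : P.map (W z) = gaussianReal 0 v := hW.map_eq z hv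
  have hind : IndepFun (W h) (W z) P := by
    refine HasGaussianLaw.indepFun_of_covariance_eq_zero
      hW.isGaussianProcess.hasGaussianLaw_prodMk ?_
    rw [covariance_eq_sub (hW.memLp h) (hW.memLp z), hW.centered, zero_mul, sub_zero]
    exact (hW.covariance h z).trans hhz
  have hprod : P.map (fun ω => (W h ω, W z ω)) = (gaussianReal 0 1).prod (gaussianReal 0 v) := by
    rw [(indepFun_iff_map_prod_eq_prod_map_map hGh.aemeasurable hGz.aemeasurable).1 hind, hmh, hmz]
  set Φ : ℝ × ℝ → ℝ := fun q => (hermiteReal n).eval q.1 * (hermiteReal n).eval (c * q.1 + q.2)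
    with hΦ
  have hΦc : Continuous Φ := by
    have := (hermiteReal n).continuous
    fun_prop
  have hpm : AEMeasurable (fun ω => (W h ω, W z ω)) P := hGh.aemeasurable.prodMk hGz.aemeasurable
  have heq : (fun ω => (hermiteReal n).eval (W h ω) * (hermiteReal n).eval (W k ω)) =ᵐ[P]
      fun ω => Φ (W h ω, W z ω) := by
    filter_upwards [hW.ae_eq c h k] with ω hω
    simp only [hΦ]
    rw [hω]
  have hint : Integrable Φ ((gaussianReal 0 1).prod (gaussianReal 0 v)) := by
    rw [← hprod, integrable_map_measure hΦc.aestronglyMeasurable hpm]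
    exact ((hW.memLp_eval (hermiteReal n) h).integrable_mul
      (hW.memLp_eval (hermiteReal n) k)).congr heq
  rw [integral_congr_ae heq, ← integral_map (φ := fun ω => (W h ω, W z ω)) hpm
    hΦc.aestronglyMeasurable, hprod, integral_prod _ hint]
  simp only [hΦ, integral_const_mul, integral_hermiteReal_gaussianReal (hv.trans hz2)]
  rw [← integral_mul_const]
  congr 1
  ext x
  ring

/-- The multiple Wiener–Itô integral is a multiple of an isometry. -/
theorem IsIsonormalGaussian.norm_sq_eq_of_mem_graph [IsProbabilityMeasure P]
    (hW : IsIsonormalGaussian W P) {n : ℕ} {p : HilbertTensorPower H n × Lp ℝ 2 P}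
    (hp : p ∈ multipleIntegralGraph W P n) :
    ‖p.2‖ ^ 2 = (∫ x, (hermiteReal n).eval x ^ 2 ∂gaussianReal 0 1) * ‖p.1‖ ^ 2 := by
  set κ := ∫ x, (hermiteReal n).eval x ^ 2 ∂gaussianReal 0 1 with hκ
  set S : Set (HilbertTensorPower H n × Lp ℝ 2 P) := {p | ∃ h : H, ‖h‖ = 1 ∧
    p.1 = hilbertTprod (fun _ : Fin n => h) ∧
      p.2 =ᵐ[P] fun ω => Polynomial.aeval (W h ω) (Polynomial.hermite n)} with hS
  -- The identity is polarized because only the bilinear version passes from generators to linear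
  -- combinations.
  have hbil : ∀ p ∈ Submodule.span ℝ S, ∀ q ∈ Submodule.span ℝ S,
      inner ℝ p.2 q.2 = κ * inner ℝ p.1 q.1 := by
    intro p hp q hq
    induction hp, hq using Submodule.span_induction₂ with
    | mem_mem p q hp hq =>
      obtain ⟨h, hh, hp1, hp2⟩ := hp
      obtain ⟨k, hk, hq1, hq2⟩ := hq
      rw [hp1, hq1, inner_hilbertTprod, L2.inner_def]
      simp only [Finset.prod_const, Finset.card_univ, Fintype.card_fin]
      rw [← hW.integral_hermite_mul n hh hk]
      refine integral_congr_ae ?_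
      filter_upwards [hp2, hq2] with ω h1 h2
      rw [h1, h2, aeval_hermite_eq, aeval_hermite_eq]
      simp [mul_comm]
    | zero_left q hq => simp
    | zero_right p hp => simp
    | add_left p p' q _ _ _ h1 h2 =>
      simp only [Prod.fst_add, Prod.snd_add, inner_add_left, h1, h2, mul_add]
    | add_right p q q' _ _ _ h1 h2 =>
      simp only [Prod.fst_add, Prod.snd_add, inner_add_right, h1, h2, mul_add]
    | smul_left r p q _ _ h1 =>
      simp only [Prod.smul_fst, Prod.smul_snd, real_inner_smul_left, h1]; ring
    | smul_right r p q _ _ h1 =>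
      simp only [Prod.smul_fst, Prod.smul_snd, real_inner_smul_right, h1]; ring
  have hcl : IsClosed {p : HilbertTensorPower H n × Lp ℝ 2 P | ‖p.2‖ ^ 2 = κ * ‖p.1‖ ^ 2} :=
    isClosed_eq (by fun_prop) (by fun_prop)
  have hsub : (Submodule.span ℝ S : Set (HilbertTensorPower H n × Lp ℝ 2 P)) ⊆
      {p | ‖p.2‖ ^ 2 = κ * ‖p.1‖ ^ 2} := by
    intro p hp
    have := hbil p hp p hp
    rwa [real_inner_self_eq_norm_sq, real_inner_self_eq_norm_sq] at this
  exact closure_minimal hsub hcl hp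

end Wiener

/-! ### Dyadic sums in a normed space -/

/-- The point `k / 2 ^ n` of the unit interval. -/
def dyadicPoint (n k : ℕ) : I := Set.projIcc 0 1 zero_le_one ((k : ℝ) / 2 ^ n)

theorem coe_dyadicPoint {n k : ℕ} (hk : k ≤ 2 ^ n) : (dyadicPoint n k : ℝ) = k / 2 ^ n := by
  have hmem : (k : ℝ) / 2 ^ n ∈ Set.Icc (0 : ℝ) 1 :=
    ⟨by positivity, by rw [div_le_one (by positivity)]; exact_mod_cast hk⟩
  rw [dyadicPoint, Set.projIcc_of_mem zero_le_one hmem]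

theorem dyadicPoint_two_mul (n k : ℕ) : dyadicPoint (n + 1) (2 * k) = dyadicPoint n k := by
  unfold dyadicPoint
  congr 1
  push_cast
  rw [pow_succ, mul_comm (2 : ℝ) k, mul_div_mul_right _ _ (by norm_num)]

theorem dyadicPoint_lt {n j k : ℕ} (hjk : j < k) (hk : k ≤ 2 ^ n) :
    dyadicPoint n j < dyadicPoint n k := by
  rw [← Subtype.coe_lt_coe, coe_dyadicPoint hk, coe_dyadicPoint (hjk.le.trans hk)]
  gcongr

theorem coe_dyadicPoint_succ_sub {n k : ℕ} (hk : k + 1 ≤ 2 ^ n) :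
    (dyadicPoint n (k + 1) : ℝ) - dyadicPoint n k = (1 / 2) ^ n := by
  rw [coe_dyadicPoint hk, coe_dyadicPoint (by omega), one_div, inv_pow]
  push_cast
  ring

/-- The left Riemann–Stieltjes sum of `g` against a vector valued path `f` over the dyadic
partition of level `n`. -/
def vectorDyadicSum {E : Type*} [AddCommGroup E] [Module ℝ E] (g : I → ℝ) (f : I → E) (n : ℕ) :
    E :=
  ∑ k ∈ Finset.range (2 ^ n),
    g (dyadicPoint n k) • (f (dyadicPoint n (k + 1)) - f (dyadicPoint n k))

theorem sum_range_two_mul {E : Type*} [AddCommMonoid E] (φ : ℕ → E) (m : ℕ) :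
    ∑ k ∈ Finset.range (2 * m), φ k = ∑ k ∈ Finset.range m, (φ (2 * k) + φ (2 * k + 1)) := by
  induction m with
  | zero => simp
  | succ m ih =>
    rw [show 2 * (m + 1) = 2 * m + 1 + 1 by ring, Finset.sum_range_succ, Finset.sum_range_succ,
      ih, Finset.sum_range_succ, add_assoc]

/-- Young's estimate for dyadic sums in a normed space. -/
theorem cauchySeq_vectorDyadicSum {E : Type*} [NormedAddCommGroup E] [NormedSpace ℝ E]
    {g : I → ℝ} {f : I → E} {L C τ α : ℝ} (hL : 0 ≤ L)
    (hg : ∀ s t : I, |g t - g s| ≤ L * |(t : ℝ) - s| ^ τ)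
    (hf : ∀ s t : I, s < t → ‖f t - f s‖ ≤ C * ((t : ℝ) - s) ^ α) (h1 : 1 < τ + α) :
    CauchySeq (vectorDyadicSum g f) := by
  set r : ℝ := (1 / 2) ^ (τ + α) with hr
  have hr0 : 0 < r := by positivity
  have hr1 : 2 * r < 1 := by
    have : r < (1 / 2) ^ (1 : ℝ) :=
      Real.rpow_lt_rpow_of_exponent_gt (by norm_num) (by norm_num) h1
    rw [Real.rpow_one] at this
    linarith
  refine cauchySeq_of_le_geometric (2 * r) (L * C * r) hr1 fun n => ?_
  -- Halving a cell changes only the weight on its right half. The `2 ^ n` changes are each of order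
  -- `r ^ (n + 1)`, whence the ratio `2 * r < 1`.
  have hdiff : vectorDyadicSum g f (n + 1) - vectorDyadicSum g f n =
      ∑ k ∈ Finset.range (2 ^ n), (g (dyadicPoint (n + 1) (2 * k + 1)) -
        g (dyadicPoint (n + 1) (2 * k))) • (f (dyadicPoint (n + 1) (2 * k + 1 + 1)) -
          f (dyadicPoint (n + 1) (2 * k + 1))) := by
    unfold vectorDyadicSum
    rw [pow_succ, mul_comm _ 2, sum_range_two_mul, ← Finset.sum_sub_distrib]
    refine Finset.sum_congr rfl fun k _ => ?_
    rw [← dyadicPoint_two_mul n k, ← dyadicPoint_two_mul n (k + 1),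
      show 2 * (k + 1) = 2 * k + 1 + 1 by ring]
    simp only [sub_smul, smul_sub]
    abel
  rw [dist_comm, dist_eq_norm, hdiff]
  have hterm : ∀ k ∈ Finset.range (2 ^ n), ‖(g (dyadicPoint (n + 1) (2 * k + 1)) -
        g (dyadicPoint (n + 1) (2 * k))) • (f (dyadicPoint (n + 1) (2 * k + 1 + 1)) -
          f (dyadicPoint (n + 1) (2 * k + 1)))‖ ≤ L * C * r ^ (n + 1) := by
    intro k hk
    have hk' : 2 * k + 1 + 1 ≤ 2 ^ (n + 1) := by
      have := Finset.mem_range.1 hk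
      rw [pow_succ]; omega
    have e1 := coe_dyadicPoint_succ_sub (n := n + 1) (k := 2 * k) (by omega)
    have e2 := coe_dyadicPoint_succ_sub (n := n + 1) (k := 2 * k + 1) hk'
    have b1 := hg (dyadicPoint (n + 1) (2 * k)) (dyadicPoint (n + 1) (2 * k + 1))
    have b2 := hf _ _ (dyadicPoint_lt (show 2 * k + 1 < 2 * k + 1 + 1 by omega) hk')
    rw [e1, abs_of_pos (by positivity : (0 : ℝ) < (1 / 2) ^ (n + 1))] at b1
    rw [e2] at b2
    rw [norm_smul, Real.norm_eq_abs]
    have e3 : r ^ (n + 1) = ((1 / 2 : ℝ) ^ (n + 1)) ^ τ * ((1 / 2 : ℝ) ^ (n + 1)) ^ α := by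
      rw [← Real.rpow_add (by positivity), hr, ← Real.rpow_natCast, ← Real.rpow_natCast,
        ← Real.rpow_mul (by norm_num), ← Real.rpow_mul (by norm_num), mul_comm]
    rw [e3]
    calc _ ≤ _ := mul_le_mul b1 b2 (norm_nonneg _) (by positivity)
      _ = _ := by ring
  refine (norm_sum_le_of_le _ hterm).trans_eq ?_
  rw [Finset.sum_const, Finset.card_range, nsmul_eq_mul]
  push_cast
  ring

/-! ### Lower bounds from the kernel assumptions -/

section Kernel

variable {E : Type*} [NormedAddCommGroup E] [InnerProductSpace ℝ E]

/-- Along a strictly increasing sequence of points, the increments outside a block cannot cancel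
a combination of the increments inside the block. -/
theorem KernelForm.mul_norm_sq_le [CompleteSpace E] {f : I → E} {β : ℝ} (hf : KernelForm f β)
    {q : ℕ → I} {M i j : ℕ} (hq : ∀ a b, a < b → b ≤ M → q a < q b)
    (hij : i < j) (hjM : j ≤ M) {c : ℕ → ℝ} (hc : c i ≠ 0) :
    β * ‖∑ k ∈ Finset.Ico i j, c k • (f (q (k + 1)) - f (q k))‖ ^ 2 ≤
      ‖∑ k ∈ Finset.range M, c k • (f (q (k + 1)) - f (q k))‖ ^ 2 := by
  set v := ∑ k ∈ Finset.Ico i j, c k • (f (q (k + 1)) - f (q k)) with hv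
  -- All points before the block go into `s` and all points after it into `r`. If `q 0 = 0` and `i >
  -- 0`, the leading `0` in the outer span merely adds a zero increment.
  set s : Fin i → I := fun e => q e with hs
  set t : Fin (j - i + 1) → I := fun e => q (i + e) with ht
  set r : Fin (M - j) → I := fun e => q (j + 1 + e) with hr
  have ht0 : t 0 = q i := by simp [ht]
  have htl : t (Fin.last (j - i)) = q j := by simp [ht, show i + (j - i) = j by omega]
  have hker := hf (j - i) i (M - j) (fun e => c (i + e)) t s r
    (fun h => hc (by simpa using congrFun h ⟨0, by omega⟩))
    (fun a b hab => hq _ _ (by simpa using hab) (by omega))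
    (fun a b hab => hq _ _ (by simpa using hab) (by omega))
    (fun a b hab => hq _ _ (by simpa using hab) (by omega))
    (fun a => by rw [ht0]; exact hq _ _ a.2 (by omega))
    (fun a => by rw [htl]; exact hq _ _ (by omega) (by omega))
  have hvt : ∑ e : Fin (j - i), c (i + e) • (f (t e.succ) - f (t e.castSucc)) = v := by
    rw [hv, Finset.sum_Ico_eq_sum_range, Finset.sum_range]
    rfl
  rw [hvt] at hker
  set U := (outerSpan f s (t 0) (t (Fin.last (j - i))) r).topologicalClosure with hU
  have hleft : ∀ k < i, f (q (k + 1)) - f (q k) ∈ U := by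
    intro k hk
    refine Submodule.le_topologicalClosure _ (Submodule.subset_span (Or.inl ?_))
    have hsn : (Fin.snoc s (t 0) : Fin (i + 1) → I) =
        fun e : Fin (i + 1) => q (e : ℕ) := by
      funext e
      induction e using Fin.lastCases with
      | last => simp [ht0]
      | cast e => simp [hs]
    -- The index is shifted by one because the list of points starts with an additional `0`.
    refine ⟨Fin.succ ⟨k, hk⟩, ?_⟩
    rw [hsn]
    beta_reduce
    rw [Fin.cons_succ, ← Fin.succ_castSucc, Fin.cons_succ]
    simp
  have hright : ∀ k, j ≤ k → k < M → f (q (k + 1)) - f (q k) ∈ U := by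
    intro k hjk hk
    refine Submodule.le_topologicalClosure _ (Submodule.subset_span (Or.inr ?_))
    have hcn : (Fin.cons (t (Fin.last (j - i))) r : Fin (M - j + 1) → I) =
        fun e : Fin (M - j + 1) => q (j + (e : ℕ)) := by
      funext e
      induction e using Fin.cases with
      | zero => simp [htl]
      | succ e => simp [hr]; congr 1; omega
    refine ⟨⟨k - j, by omega⟩, ?_⟩
    rw [hcn]
    simp only [Fin.val_succ, Fin.val_castSucc]
    rw [show j + (k - j + 1) = k + 1 by omega, show j + (k - j) = k by omega]
  have hsplit : ∑ k ∈ Finset.range M, c k • (f (q (k + 1)) - f (q k)) =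
      v + (∑ k ∈ Finset.range i, c k • (f (q (k + 1)) - f (q k)) +
        ∑ k ∈ Finset.Ico j M, c k • (f (q (k + 1)) - f (q k))) := by
    rw [← Finset.sum_range_add_sum_Ico _ hjM, ← Finset.sum_range_add_sum_Ico _ hij.le, hv]
    abel
  set w := ∑ k ∈ Finset.range i, c k • (f (q (k + 1)) - f (q k)) +
        ∑ k ∈ Finset.Ico j M, c k • (f (q (k + 1)) - f (q k)) with hw
  have hwU : w ∈ U := by
    refine U.add_mem (U.sum_mem fun k hk => U.smul_mem _ (hleft k (Finset.mem_range.1 hk)))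
      (U.sum_mem fun k hk => U.smul_mem _ ?_)
    exact hright k (Finset.mem_Ico.1 hk).1 (Finset.mem_Ico.1 hk).2
  rw [hsplit]
  refine hker.le.trans (pow_le_pow_left₀ (norm_nonneg _) ?_ 2)
  -- The projection residual is the distance from `v` to `U`, and `-w` is a competitor in that
  -- infimum.
  rw [Submodule.starProjection_minimal]
  have := ciInf_le (f := fun x : U => ‖v - x‖) ⟨0, by rintro _ ⟨x, rfl⟩; exact norm_nonneg _⟩
    ⟨-w, U.neg_mem hwU⟩
  simpa using this

/-- If all row sums of the Gram matrix are non-negative, then lowering all the (large) weights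
to a constant decreases the norm of a weighted sum. -/
theorem mul_norm_sum_sq_le {ι : Type*} {s : Finset ι} {Δ : ι → E} {a : ι → ℝ} {m : ℝ} (hm : 0 ≤ m)
    (ha : ∀ k ∈ s, m ≤ a k) (hΔ : ∀ k ∈ s, 0 ≤ inner ℝ (Δ k) (∑ l ∈ s, Δ l)) :
    m ^ 2 * ‖∑ k ∈ s, Δ k‖ ^ 2 ≤ ‖∑ k ∈ s, a k • Δ k‖ ^ 2 := by
  set V := ∑ k ∈ s, Δ k with hV
  -- The excess weights `a k - m` are non-negative and each `Δ k` pairs non-negatively with the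
  -- total `V`, so the cross term may be dropped.
  have e : ∑ k ∈ s, a k • Δ k = ∑ k ∈ s, (a k - m) • Δ k + m • V := by
    rw [hV, Finset.smul_sum, ← Finset.sum_add_distrib]
    exact Finset.sum_congr rfl fun k _ => by rw [← add_smul, sub_add_cancel]
  have hin : 0 ≤ inner ℝ (∑ k ∈ s, (a k - m) • Δ k) V := by
    rw [sum_inner]
    refine Finset.sum_nonneg fun k hk => ?_
    rw [real_inner_smul_left]
    exact mul_nonneg (sub_nonneg.2 (ha k hk)) (hΔ k hk)
  rw [e, norm_add_sq_real, real_inner_smul_right, norm_smul, mul_pow, Real.norm_eq_abs, sq_abs]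
  have := mul_nonneg hm hin
  nlinarith [sq_nonneg ‖∑ k ∈ s, (a k - m) • Δ k‖]

/-- The limit of the dyadic sums of a weight that is at least `m` on `[a, b]` is bounded below. -/
theorem KernelForm.mul_norm_sub_sq_le [CompleteSpace E] {f : I → E} {β : ℝ}
    (hf : KernelForm f β) (hβ : 0 ≤ β) (hrow : NonnegRowSum f) (hfc : Continuous f) {g : I → ℝ}
    {a b : I} (hab : a < b) {m : ℝ} (hm : 0 < m) (hg : ∀ u, a ≤ u → u ≤ b → m ≤ g u) {Z : E}
    (hZ : Tendsto (vectorDyadicSum g f) atTop (𝓝 Z)) :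
    β * m ^ 2 * ‖f b - f a‖ ^ 2 ≤ ‖Z‖ ^ 2 := by
  -- Rounding `a` up and `b` down keeps the grid block inside `[a, b]`, where the weights are at
  -- least `m`.
  set i : ℕ → ℕ := fun n => ⌈(a : ℝ) * 2 ^ n⌉₊ with hi
  set j : ℕ → ℕ := fun n => ⌊(b : ℝ) * 2 ^ n⌋₊ with hj
  have hti : Tendsto (fun n => (i n : ℝ) / 2 ^ n) atTop (𝓝 (a : ℝ)) := tendsto_ceil_dyadic a.2.1
  have htj : Tendsto (fun n => (j n : ℝ) / 2 ^ n) atTop (𝓝 (b : ℝ)) := tendsto_floor_dyadic b.2.1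
  have hpi : Tendsto (fun n => dyadicPoint n (i n)) atTop (𝓝 a) := by
    have := (continuous_projIcc (h := zero_le_one' ℝ)).tendsto (a : ℝ)
    rw [Set.projIcc_val] at this
    exact this.comp hti
  have hpj : Tendsto (fun n => dyadicPoint n (j n)) atTop (𝓝 b) := by
    have := (continuous_projIcc (h := zero_le_one' ℝ)).tendsto (b : ℝ)
    rw [Set.projIcc_val] at this
    exact this.comp htj
  have hlim := ((((hfc.tendsto b).comp hpj).sub ((hfc.tendsto a).comp hpi)).norm.pow 2).const_mul
    (β * m ^ 2)
  refine le_of_tendsto_of_tendsto hlim (hZ.norm.pow 2) ?_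
  filter_upwards [hti.eventually_lt htj (Subtype.coe_lt_coe.2 hab)] with n hn
  have hp : (0 : ℝ) < 2 ^ n := by positivity
  have hij : i n < j n := by
    rw [div_lt_div_iff_of_pos_right hp] at hn
    exact_mod_cast hn
  have hbj : (j n : ℝ) ≤ b * 2 ^ n := Nat.floor_le (mul_nonneg b.2.1 hp.le)
  have hai : (a : ℝ) * 2 ^ n ≤ i n := Nat.le_ceil _
  have hj2 : j n ≤ 2 ^ n := by
    have : (j n : ℝ) ≤ 2 ^ n := hbj.trans (mul_le_of_le_one_left hp.le b.2.2)
    exact_mod_cast this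
  have hmem : ∀ k, i n ≤ k → k ≤ j n → a ≤ dyadicPoint n k ∧ dyadicPoint n k ≤ b := by
    intro k h1 h2
    have h1' : (i n : ℝ) ≤ k := by exact_mod_cast h1
    have h2' : (k : ℝ) ≤ j n := by exact_mod_cast h2
    rw [← Subtype.coe_le_coe, ← Subtype.coe_le_coe, coe_dyadicPoint (h2.trans hj2),
      le_div_iff₀ hp, div_le_iff₀ hp]
    exact ⟨by linarith, by linarith⟩
  have hmono : ∀ k l, k ≤ l → l ≤ 2 ^ n → dyadicPoint n k ≤ dyadicPoint n l := by
    intro k l h1 h2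
    rcases h1.eq_or_lt with rfl | h
    · exact le_rfl
    · exact (dyadicPoint_lt h h2).le
  have htel : ∑ k ∈ Finset.Ico (i n) (j n), (f (dyadicPoint n (k + 1)) - f (dyadicPoint n k)) =
      f (dyadicPoint n (j n)) - f (dyadicPoint n (i n)) :=
    Finset.sum_Ico_sub (fun k => f (dyadicPoint n k)) hij.le
  have hqp := mul_norm_sum_sq_le (s := Finset.Ico (i n) (j n))
    (Δ := fun k => f (dyadicPoint n (k + 1)) - f (dyadicPoint n k))
    (a := fun k => g (dyadicPoint n k)) hm.le
    (fun k hk => by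
      obtain ⟨h1, h2⟩ := Finset.mem_Ico.1 hk
      exact hg _ (hmem k h1 h2.le).1 (hmem k h1 h2.le).2)
    (fun k hk => by
      obtain ⟨h1, h2⟩ := Finset.mem_Ico.1 hk
      rw [htel]
      exact hrow _ _ _ _ (hmono _ _ h1 (by omega)) (hmono _ _ (by omega) (by omega))
        (hmono _ _ (by omega) hj2))
  rw [htel] at hqp
  have hk := hf.mul_norm_sq_le (q := dyadicPoint n) (M := 2 ^ n)
    (fun a b h1 h2 => dyadicPoint_lt h1 h2) hij hj2 (c := fun k => g (dyadicPoint n k))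
    (hm.trans_le (hg _ (hmem _ le_rfl hij.le).1 (hmem _ le_rfl hij.le).2)).ne'
  refine le_trans ?_ hk
  rw [mul_assoc]
  exact mul_le_mul_of_nonneg_left hqp hβ

/-- The interpolation inequality in the kernel space: the limit of the dyadic sums is bounded
below by the supremum of the weight and the increment of the kernel over a long interval. -/
theorem KernelForm.interpolation [CompleteSpace E] {f : I → E} {β : ℝ}
    (hf : KernelForm f β) (hβ : 0 ≤ β) (hrow : NonnegRowSum f) (hfc : Continuous f) {g : I → ℝ}
    {L τ : ℝ} (hL : 0 < L) (hτ : 0 < τ) (hg : ∀ s t : I, |g t - g s| ≤ L * |(t : ℝ) - s| ^ τ)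
    {Z : E} (hZ : Tendsto (vectorDyadicSum g f) atTop (𝓝 Z)) :
    β / 4 * (⨆ r, |g r|) ^ 2 * ‖f 1 - f 0‖ ^ 2 ≤ ‖Z‖ ^ 2 ∨
      ∃ a b : I, a ≤ b ∧ ((⨆ r, |g r|) / (2 * L)) ^ (1 / τ) ≤ (b : ℝ) - a ∧
        β / 4 * (⨆ r, |g r|) ^ 2 * ‖f b - f a‖ ^ 2 ≤ ‖Z‖ ^ 2 := by
  have hgc := continuous_of_abs_sub_le_rpow hτ hg
  obtain ⟨r, -, hr⟩ := isCompact_univ.exists_isMaxOn Set.univ_nonempty hgc.abs.continuousOn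
  have hmax : ∀ u, |g u| ≤ |g r| := fun u => hr (Set.mem_univ u)
  have hG : ⨆ u, |g u| = |g r| :=
    le_antisymm (ciSup_le hmax) (le_ciSup (f := fun u => |g u|)
    ⟨|g r|, by rintro _ ⟨u, rfl⟩; exact hmax u⟩ r)
  rw [hG]
  clear hr hG
  -- Changing the sign of `g` changes the sign of the limit `Z` and leaves every norm unchanged.
  wlog hpos : 0 ≤ g r generalizing g Z
  · have h := this (g := fun u => -g u) (Z := -Z)
      (fun s t => by rw [← neg_sub_neg, neg_neg, neg_neg, abs_sub_comm]; exact hg s t) ?_ hgc.neg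
      (by simpa using hmax) (by linarith)
    · simpa only [abs_neg, norm_neg] using h
    · have : vectorDyadicSum (fun u => -g u) f = fun n => -vectorDyadicSum g f n := by
        funext n
        simp [vectorDyadicSum, Finset.sum_neg_distrib]
      rw [this]
      exact hZ.neg
  rw [abs_of_nonneg hpos] at hmax ⊢
  rcases hpos.eq_or_lt with h0 | hpos'
  · left
    rw [← h0]
    simp
  set G := g r with hGdef
  have hm : 0 < G / 2 := by linarith
  have hconst : ∀ y : ℝ, β / 4 * G ^ 2 * y = β * (G / 2) ^ 2 * y := fun y => by ring
  simp only [hconst]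
  by_cases hall : ∀ u, G / 2 ≤ g u
  · exact Or.inl (hf.mul_norm_sub_sq_le hβ hrow hfc zero_lt_one hm (fun u _ _ => hall u) hZ)
  right
  push Not at hall
  obtain ⟨u, hu⟩ := hall
  -- The length is chosen so that the Hölder bound loses exactly `G / 2` over it.
  set ℓ := (G / (2 * L)) ^ (1 / τ) with hℓ
  have hℓ0 : 0 < ℓ := by positivity
  have hℓτ : L * ℓ ^ τ = G / 2 := by
    rw [hℓ, ← Real.rpow_mul (by positivity), one_div_mul_cancel hτ.ne', Real.rpow_one]
    field_simp
  have hnear : ∀ w : I, |(w : ℝ) - r| ≤ ℓ → G / 2 ≤ g w := by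
    intro w hw
    have h1 := hg r w
    have h2 : L * |(w : ℝ) - r| ^ τ ≤ L * ℓ ^ τ :=
      mul_le_mul_of_nonneg_left (Real.rpow_le_rpow (abs_nonneg _) hw hτ.le) hL.le
    rw [hℓτ] at h2
    have h3 := (abs_le.1 (h1.trans h2)).1
    rw [← hGdef] at h3
    linarith
  have hfar : ℓ < |(u : ℝ) - r| := by
    by_contra hcon
    exact absurd (hnear u (not_lt.1 hcon)) (not_le.2 hu)
  -- A point `u` with `g u < G / 2` lies farther than `ℓ` from `r`, so the interval of length `ℓ`
  -- from `r` towards `u` fits in `[0, 1]`.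
  rcases lt_abs.1 hfar with h | h
  · have hmem : (r : ℝ) + ℓ ∈ I := ⟨by linarith [r.2.1], by linarith [u.2.2]⟩
    have hlt : r < ⟨(r : ℝ) + ℓ, hmem⟩ := Subtype.coe_lt_coe.1 (by simpa using hℓ0)
    refine ⟨r, ⟨(r : ℝ) + ℓ, hmem⟩, hlt.le, by simp, ?_⟩
    refine hf.mul_norm_sub_sq_le hβ hrow hfc hlt hm (fun w h1 h2 => hnear w ?_) hZ
    have h1' : (r : ℝ) ≤ w := h1
    have h2' : (w : ℝ) ≤ r + ℓ := h2
    rw [abs_le]; constructor <;> linarith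
  · have hmem : (r : ℝ) - ℓ ∈ I := ⟨by linarith [u.2.1], by linarith [r.2.2]⟩
    have hlt : ⟨(r : ℝ) - ℓ, hmem⟩ < r := Subtype.coe_lt_coe.1 (by simpa using hℓ0)
    refine ⟨⟨(r : ℝ) - ℓ, hmem⟩, r, hlt.le, by simp, ?_⟩
    refine hf.mul_norm_sub_sq_le hβ hrow hfc hlt hm (fun w h1 h2 => hnear w ?_) hZ
    have h1' : (r : ℝ) - ℓ ≤ w := h1
    have h2' : (w : ℝ) ≤ r := h2
    rw [abs_le]; constructor <;> linarith

end Kernel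

/-! ### Processes with Hölder continuous second moments -/

section SecondMoments

variable {Ω : Type*} [MeasurableSpace Ω] {P : Measure Ω}

theorem norm_toLp_sq {F : Ω → ℝ} (hF : MemLp F 2 P) : ‖hF.toLp F‖ ^ 2 = ∫ ω, F ω ^ 2 ∂P := by
  rw [← real_inner_self_eq_norm_sq, L2.inner_def]
  refine integral_congr_ae ?_
  filter_upwards [hF.coeFn_toLp] with ω h
  rw [h]
  simp [sq]

theorem ae_summable_of_summable_integral {u : ℕ → Ω → ℝ} (hu : ∀ n ω, 0 ≤ u n ω)
    (hi : ∀ n, Integrable (u n) P) (hs : Summable fun n => ∫ ω, u n ω ∂P) :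
    ∀ᵐ ω ∂P, Summable fun n => u n ω := by
  have h := summable_norm_of_tsum_eLpNorm_ne_top (μ := P) (p := 1) le_rfl
    (fun n => (hi n).aestronglyMeasurable) ?_
  · filter_upwards [h] with ω hω
    simpa only [Real.norm_eq_abs, abs_of_nonneg (hu _ _)] using hω
  · have e : ∀ n, eLpNorm (u n) 1 P = ENNReal.ofReal (∫ ω, u n ω ∂P) := fun n => by
      rw [eLpNorm_one_eq_lintegral_enorm, ← ofReal_integral_norm_eq_lintegral_enorm (hi n)]
      simp only [Real.norm_eq_abs, abs_of_nonneg (hu _ _)]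
    simp only [e]
    exact hs.tsum_ofReal_ne_top

/-- A process whose increments have second moments of order `|t - s| ^ θ` has almost surely
finite dyadic energy. -/
theorem ae_finiteDyadicEnergy {X : I → Ω → ℝ} {γ θ K : ℝ} (hγ : γ + 1 < θ)
    (hX : ∀ t, MemLp (X t) 2 P)
    (hinc : ∀ s t : I, s < t → ∫ ω, (X t ω - X s ω) ^ 2 ∂P ≤ K * ((t : ℝ) - s) ^ θ) :
    ∀ᵐ ω ∂P, FiniteDyadicEnergy γ (Set.IccExtend zero_le_one fun t => X t ω) := by
  have hvar : ∀ n ω, dyadicVariation (Set.IccExtend zero_le_one fun t => X t ω) n =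
      ∑ k ∈ Finset.range (2 ^ n),
        (X (dyadicPoint n (k + 1)) ω - X (dyadicPoint n k) ω) ^ 2 := by
    intro n ω
    refine Finset.sum_congr rfl fun k _ => ?_
    rw [← Nat.cast_add_one]
    rfl
  have hi : ∀ s t, Integrable (fun ω => (X t ω - X s ω) ^ 2) P := fun s t =>
    ((hX t).sub (hX s)).integrable_sq
  have hI : ∀ n : ℕ, Integrable (fun ω => ((2 : ℝ) ^ γ) ^ n *
      dyadicVariation (Set.IccExtend zero_le_one fun t => X t ω) n) P := by
    intro n
    simp only [hvar]
    exact (integrable_finsetSum _ fun k _ => hi _ _).const_mul _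
  refine ae_summable_of_summable_integral (fun n ω => ?_) hI ?_
  · rw [hvar]
    exact mul_nonneg (by positivity) (Finset.sum_nonneg fun _ _ => sq_nonneg _)
  -- Level `n` has weight `2 ^ (γ n)` and `2 ^ n` increments of second moment at most `K * 2 ^ (-θ
  -- n)`.
  set r : ℝ := 2 ^ (γ + 1 - θ) with hr
  have hr1 : r < 1 := Real.rpow_lt_one_of_one_lt_of_neg (by norm_num) (by linarith)
  refine Summable.of_nonneg_of_le (fun n => integral_nonneg fun ω => ?_) (fun n => ?_)
    ((summable_geometric_of_lt_one (by positivity) hr1).mul_left K)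
  · rw [hvar]
    exact mul_nonneg (by positivity) (Finset.sum_nonneg fun _ _ => sq_nonneg _)
  simp only [hvar]
  rw [integral_const_mul, integral_finsetSum _ fun k _ => hi _ _]
  have hb : ∀ k ∈ Finset.range (2 ^ n),
      ∫ ω, (X (dyadicPoint n (k + 1)) ω - X (dyadicPoint n k) ω) ^ 2 ∂P ≤
        K * ((1 / 2 : ℝ) ^ n) ^ θ := by
    intro k hk
    have hk' : k + 1 ≤ 2 ^ n := Finset.mem_range.1 hk
    rw [← coe_dyadicPoint_succ_sub hk']
    exact hinc _ _ (dyadicPoint_lt (Nat.lt_succ_self k) hk')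
  refine (mul_le_mul_of_nonneg_left (Finset.sum_le_sum hb) (by positivity)).trans_eq ?_
  rw [Finset.sum_const, Finset.card_range, nsmul_eq_mul]
  have e : r ^ n = ((2 : ℝ) ^ γ) ^ n * 2 ^ n * ((1 / 2 : ℝ) ^ n) ^ θ := by
    rw [hr, one_div, ← Real.rpow_neg_one 2, ← Real.rpow_natCast, ← Real.rpow_natCast,
      ← Real.rpow_natCast, ← Real.rpow_natCast, ← Real.rpow_mul (by norm_num),
      ← Real.rpow_mul (by norm_num), ← Real.rpow_mul (by norm_num), ← Real.rpow_mul (by norm_num),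
      ← Real.rpow_add (by norm_num), ← Real.rpow_add (by norm_num)]
    congr 1
    ring
  rw [e]
  push_cast
  ring

theorem coeFn_vectorDyadicSum {X : I → Ω → ℝ} (hX : ∀ t, MemLp (X t) 2 P) (g : I → ℝ) (n : ℕ) :
    (vectorDyadicSum g (fun t => ((hX t).toLp (X t) : Lp ℝ 2 P)) n : Lp ℝ 2 P) =ᵐ[P] fun ω =>
      dyadicSum (Set.IccExtend zero_le_one g) (Set.IccExtend zero_le_one fun t => X t ω) n := by
  have hterm : ∀ k, ∀ᵐ ω ∂P, (g (dyadicPoint n k) • ((hX (dyadicPoint n (k + 1))).toLp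
      (X (dyadicPoint n (k + 1))) - (hX (dyadicPoint n k)).toLp (X (dyadicPoint n k))) : Lp ℝ 2 P) ω =
      g (dyadicPoint n k) * (X (dyadicPoint n (k + 1)) ω - X (dyadicPoint n k) ω) := by
    intro k
    filter_upwards [Lp.coeFn_smul (g (dyadicPoint n k)) ((hX (dyadicPoint n (k + 1))).toLp
      (X (dyadicPoint n (k + 1))) - (hX (dyadicPoint n k)).toLp (X (dyadicPoint n k))),
      Lp.coeFn_sub ((hX (dyadicPoint n (k + 1))).toLp (X (dyadicPoint n (k + 1))))
        ((hX (dyadicPoint n k)).toLp (X (dyadicPoint n k))),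
      (hX (dyadicPoint n (k + 1))).coeFn_toLp, (hX (dyadicPoint n k)).coeFn_toLp] with ω h1 h2 h3 h4
    rw [h1, Pi.smul_apply, h2, Pi.sub_apply, h3, h4, smul_eq_mul]
  filter_upwards [Lp.coeFn_fun_finsetSum (Finset.range (2 ^ n)) fun k => (g (dyadicPoint n k) •
    ((hX (dyadicPoint n (k + 1))).toLp (X (dyadicPoint n (k + 1))) -
      (hX (dyadicPoint n k)).toLp (X (dyadicPoint n k))) : Lp ℝ 2 P),
    ae_all_iff.2 hterm] with ω h1 h2
  rw [vectorDyadicSum, h1, dyadicSum]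
  refine Finset.sum_congr rfl fun k _ => ?_
  rw [h2 k, ← Nat.cast_add_one]
  rfl

end SecondMoments

theorem hasYoungIntegral_youngIntegral {g x : I → ℝ} (h : ∃ J, HasYoungIntegral g x J) :
    HasYoungIntegral g x (youngIntegral g x) := by
  rw [youngIntegral, dif_pos h]
  exact h.choose_spec

/-- The interpolation inequality for a process with values in a closed subspace of `L²` that is,
up to the constant `κ`, isometric to the space of the kernels. -/
theorem interpolation_of_isometry {E : Type*} [NormedAddCommGroup E] [InnerProductSpace ℝ E]
    [CompleteSpace E] {Ω : Type*} [MeasurableSpace Ω] {P : Measure Ω} [IsProbabilityMeasure P]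
    {κ : ℝ} (hκ0 : 0 ≤ κ) {Γ : Submodule ℝ (E × Lp ℝ 2 P)}
    (hΓ : ∀ p ∈ Γ, ‖p.2‖ ^ 2 = κ * ‖p.1‖ ^ 2)
    {f : I → E} {X : I → Ω → ℝ} (hm : ∀ t, MemLp (X t) 2 P)
    (hgraph : ∀ t, (f t, (hm t).toLp (X t)) ∈ Γ)
    (hXcont : ∀ᵐ ω ∂P, Continuous fun t => X t ω)
    {θ : ℝ} (hreg : KernelRegularity f θ)
    {β : ℝ} (hβ0 : 0 < β) (hker : KernelForm f β) (hrow : NonnegRowSum f)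
    {τ : ℝ≥0} (hτ : 0 < τ) (hexp : 1 < (τ : ℝ) + θ / 2)
    {g : I → ℝ} (hg : MemHolder τ g) (hg0 : nnHolderNorm τ g ≠ 0) :
    (∀ᵐ ω ∂P, HasYoungIntegral g (fun t => X t ω) (youngIntegral g fun t => X t ω)) ∧
    MemLp (fun ω => youngIntegral g fun t => X t ω) 2 P ∧
    (β / 4 * (⨆ r, |g r|) ^ 2 * ∫ ω, X 1 ω ^ 2 ∂P
        ≤ ∫ ω, (youngIntegral g fun t => X t ω) ^ 2 ∂P ∨
      ∃ a b : I, a ≤ b ∧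
        ((⨆ r, |g r|) / (2 * (nnHolderNorm τ g : ℝ))) ^ (1 / (τ : ℝ)) ≤ (b : ℝ) - a ∧
        β / 4 * (⨆ r, |g r|) ^ 2 * ∫ ω, (X b ω - X a ω) ^ 2 ∂P
          ≤ ∫ ω, (youngIntegral g fun t => X t ω) ^ 2 ∂P) := by
  have hL : 0 < (nnHolderNorm τ g : ℝ) := by
    exact_mod_cast pos_iff_ne_zero.2 hg0
  have hτ' : (0 : ℝ) < τ := by exact_mod_cast hτ
  have hgH : ∀ s t : I, |g t - g s| ≤ nnHolderNorm τ g * |(t : ℝ) - s| ^ (τ : ℝ) := by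
    intro s t
    have := hg.holderWith.dist_le t s
    rwa [Real.dist_eq, Subtype.dist_eq, Real.dist_eq] at this
  obtain ⟨hθ, hf0, C, hC, hfC⟩ := hreg
  set Y : I → Lp ℝ 2 P := fun t => (hm t).toLp (X t) with hY
  -- isometry for increments and for dyadic sums
  have hYinc : ∀ s t, ‖Y t - Y s‖ ^ 2 = κ * ‖f t - f s‖ ^ 2 := by
    intro s t
    have h := hΓ (f t - f s, Y t - Y s) (Γ.sub_mem (hgraph t) (hgraph s))
    exact h
  have hinc : ∀ s t, ∫ ω, (X t ω - X s ω) ^ 2 ∂P = κ * ‖f t - f s‖ ^ 2 := by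
    intro s t
    rw [← hYinc, hY]
    beta_reduce
    rw [← MemLp.toLp_sub (hm t) (hm s), norm_toLp_sq ((hm t).sub (hm s))]
    simp only [Pi.sub_apply]
  have hsum : ∀ N, ‖vectorDyadicSum g Y N‖ ^ 2 = κ * ‖vectorDyadicSum g f N‖ ^ 2 := by
    intro N
    have hmem : vectorDyadicSum g (fun t => (f t, Y t)) N ∈ Γ :=
      Submodule.sum_mem _ fun k _ =>
        Submodule.smul_mem _ _ (Submodule.sub_mem _ (hgraph _) (hgraph _))
    have h1 := hΓ _ hmem
    simpa only [vectorDyadicSum, Prod.fst_sum, Prod.snd_sum, Prod.smul_fst, Prod.smul_snd,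
      Prod.fst_sub, Prod.snd_sub] using h1
  -- limits of the dyadic sums
  obtain ⟨Z, hZ⟩ := cauchySeq_tendsto_of_complete
    (cauchySeq_vectorDyadicSum hL.le hgH (fun s t hst => (hfC s t hst).2) hexp)
  obtain ⟨V, hV⟩ := cauchySeq_tendsto_of_complete
    (cauchySeq_vectorDyadicSum (f := Y) (C := √κ * C) hL.le hgH (fun s t hst => by
      have h1 : ‖Y t - Y s‖ = √κ * ‖f t - f s‖ := by
        rw [← Real.sqrt_sq (norm_nonneg (Y t - Y s)), hYinc, Real.sqrt_mul hκ0,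
          Real.sqrt_sq (norm_nonneg _)]
      rw [h1, mul_assoc]
      exact mul_le_mul_of_nonneg_left (hfC s t hst).2 (Real.sqrt_nonneg _)) hexp)
  have hVZ : ‖V‖ ^ 2 = κ * ‖Z‖ ^ 2 := by
    refine tendsto_nhds_unique (hV.norm.pow 2) ?_
    simp only [hsum]
    exact (hZ.norm.pow 2).const_mul κ
  -- pathwise existence
  obtain ⟨γ, hγ1, hγ2⟩ : ∃ γ : ℝ, max (0 : ℝ) (1 - 2 * (τ : ℝ)) < γ ∧ γ < θ - 1 :=
    exists_between (max_lt (by linarith) (by linarith))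
  have hγ0 : 0 < γ := (le_max_left _ _).trans_lt hγ1
  have hγτ : 1 - 2 * (τ : ℝ) < γ := (le_max_right _ _).trans_lt hγ1
  have henergy := ae_finiteDyadicEnergy (P := P) (X := X) (γ := γ) (θ := θ) (K := κ * C ^ 2)
    (by linarith) hm (fun s t hst => by
      rw [hinc, mul_assoc]
      refine mul_le_mul_of_nonneg_left ?_ hκ0
      have hst' : (0 : ℝ) ≤ (t : ℝ) - s := sub_nonneg.2 hst.le
      refine (pow_le_pow_left₀ (norm_nonneg _) (hfC s t hst).2 2).trans_eq ?_
      rw [mul_pow, ← Real.rpow_natCast (_ ^ (θ / 2)), ← Real.rpow_mul hst']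
      congr 2
      push_cast
      ring)
  have hyoung : ∀ᵐ ω ∂P, HasYoungIntegral g (fun t => X t ω)
      (youngIntegral g fun t => X t ω) := by
    filter_upwards [henergy, hXcont] with ω h1 h2
    exact hasYoungIntegral_youngIntegral
      (exists_hasYoungIntegral hγ0 h2 h1 hL.le hτ' hgH (by linarith))
  -- The same dyadic sums converge to `V` in `L²` and to the Young integral pathwise. This also
  -- supplies the measurability of the integral.
  have hVJ : V =ᵐ[P] fun ω => youngIntegral g fun t => X t ω := by
    obtain ⟨ns, hns, hlim⟩ := (tendstoInMeasure_of_tendsto_Lp hV).exists_seq_tendsto_ae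
    filter_upwards [hlim, hyoung, ae_all_iff.2 fun N => coeFn_vectorDyadicSum hm g N]
      with ω h1 h2 h3
    refine tendsto_nhds_unique h1 ?_
    have h4 := h2.tendsto_dyadicSum.comp hns.tendsto_atTop
    exact h4.congr fun i => (h3 (ns i)).symm
  have hJ : MemLp (fun ω => youngIntegral g fun t => X t ω) 2 P := (Lp.memLp V).ae_eq hVJ
  have hJV : ∫ ω, (youngIntegral g fun t => X t ω) ^ 2 ∂P = κ * ‖Z‖ ^ 2 := by
    rw [← hVZ, ← norm_toLp_sq hJ]
    congr 2
    exact Lp.ext ((hJ.coeFn_toLp).trans hVJ.symm)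
  refine ⟨hyoung, hJ, ?_⟩
  have hfc : Continuous f := by
    refine continuous_iff_continuousAt.2 fun s => tendsto_iff_dist_tendsto_zero.2 ?_
    have hb : ∀ t : I, dist (f t) (f s) ≤ C * |(t : ℝ) - s| ^ (θ / 2) := by
      intro t
      rw [dist_eq_norm]
      rcases lt_trichotomy s t with h | rfl | h
      · rw [abs_of_pos (sub_pos.2 (Subtype.coe_lt_coe.2 h))]
        exact (hfC s t h).2
      · rw [sub_self, norm_zero]; positivity
      · rw [norm_sub_rev, abs_sub_comm, abs_of_pos (sub_pos.2 (Subtype.coe_lt_coe.2 h))]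
        exact (hfC t s h).2
    have hlim : Tendsto (fun t : I => C * |(t : ℝ) - s| ^ (θ / 2)) (𝓝 s)
        (𝓝 (C * |(s : ℝ) - s| ^ (θ / 2))) := by
      have : Continuous fun t : I => C * |(t : ℝ) - s| ^ (θ / 2) :=
        continuous_const.mul ((continuous_subtype_val.sub continuous_const).abs.rpow_const
          fun _ => Or.inr (by linarith))
      exact this.tendsto s
    rw [sub_self, abs_zero, Real.zero_rpow (by linarith), mul_zero] at hlim
    exact squeeze_zero (fun _ => dist_nonneg) hb hlim
  have h10 : ∫ ω, X 1 ω ^ 2 ∂P = κ * ‖f 1 - f 0‖ ^ 2 := by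
    have h1 := hΓ _ (hgraph 1)
    rw [hf0, sub_zero, ← norm_toLp_sq (hm 1)]
    exact h1
  have hscale : ∀ y : ℝ, β / 4 * (⨆ r, |g r|) ^ 2 * y ≤ ‖Z‖ ^ 2 →
      β / 4 * (⨆ r, |g r|) ^ 2 * (κ * y) ≤ κ * ‖Z‖ ^ 2 := fun y hy => by
    calc _ = κ * (β / 4 * (⨆ r, |g r|) ^ 2 * y) := by ring
      _ ≤ _ := mul_le_mul_of_nonneg_left hy hκ0
  rw [hJV, h10]
  rcases hker.interpolation hβ0.le hrow hfc hL hτ' hgH hZ with h | ⟨a, b, hab, hlen, h⟩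
  · exact Or.inl (hscale _ h)
  · exact Or.inr ⟨a, b, hab, hlen, by rw [hinc]; exact hscale _ h⟩

end

theorem mainTheorem3
    {H : Type*} [NormedAddCommGroup H] [InnerProductSpace ℝ H] [CompleteSpace H]
    [TopologicalSpace.SeparableSpace H]
    {Ω : Type*} [MeasurableSpace Ω] (P : Measure Ω) [IsProbabilityMeasure P]
    (W : H → Ω → ℝ) (hW : IsIsonormalGaussian W P)
    (n : ℕ) (hn : 1 ≤ n)
    (f : I → HilbertTensorPower H n) (X : I → Ω → ℝ)
    (hX : ∀ t, IsMultipleIntegral W P n (f t) (X t))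
    (hXcont : ∀ᵐ ω ∂P, Continuous fun t => X t ω)
    (θ : ℝ) (hreg : KernelRegularity f θ)
    (β : ℝ) (hβ0 : 0 < β) (hβ1 : β < 1) (hker : KernelForm f β)
    (hrow : NonnegRowSum f)
    (ρ : ℝ) (hρ : ρ < θ / 2)
    (τ : ℝ≥0) (hτ : 0 < τ) (hτρ : 1 < (τ : ℝ) + ρ)
    (g : I → ℝ) (hg : MemHolder τ g) (hg0 : nnHolderNorm τ g ≠ 0) :
    (∀ᵐ ω ∂P, HasYoungIntegral g (fun t => X t ω) (youngIntegral g fun t => X t ω)) ∧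
    MemLp (fun ω => youngIntegral g fun t => X t ω) 2 P ∧
    (β / 4 * (⨆ r, |g r|) ^ 2 * ∫ ω, X 1 ω ^ 2 ∂P
        ≤ ∫ ω, (youngIntegral g fun t => X t ω) ^ 2 ∂P ∨
      ∃ a b : I, a ≤ b ∧
        ((⨆ r, |g r|) / (2 * (nnHolderNorm τ g : ℝ))) ^ (1 / (τ : ℝ)) ≤ (b : ℝ) - a ∧
        β / 4 * (⨆ r, |g r|) ^ 2 * ∫ ω, (X b ω - X a ω) ^ 2 ∂P
          ≤ ∫ ω, (youngIntegral g fun t => X t ω) ^ 2 ∂P) := by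
  choose hm hgraph using hX
  -- Here `κ` is the second moment of `Hₙ` under the standard Gaussian law, and `ρ < θ / 2` turns `τ
  -- + ρ > 1` into `τ + θ / 2 > 1`.
  exact interpolation_of_isometry (integral_nonneg fun x => sq_nonneg _)
    (fun p hp => hW.norm_sq_eq_of_mem_graph hp) hm hgraph hXcont hreg hβ0 hker hrow hτ
    (by linarith) hg hg0
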